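/- Conventions. For a real-analytic submanifold $M\subset\mathbb C^m$, let $T^{0,1}_qM$ be the space of vectors of $\mathbb C\otimes T_qM$ that lie in the span of $\partial/\partial\bar z_1,\dots,\partial/\partial\bar z_m$. $M$ is CR singular at $q\in M$ if $\dim T^{0,1}_{q'}M$ is not constant for $q'$ in any neighborhood of $q$ in $M$, and $M$ is a CR submanifold if it has no CR singularities. A real-analytic submanifold $N\subset\mathbb C^n$ is generic if $T_pN+iT_pN=T_p\mathbb C^n$ for all $p\in N$. For a holomorphic map $F$ on an open set $U\subset\mathbb C^n$, $DF$ denotes the holomorphic derivative; it is generically of rank $n$ if it is of rank $n$ on an open dense subset of $U$. $\|\cdot\|_W$ is the supremum norm over $W$, and "$F|_N$ is a diffeomorphism" means that $F|_N$ is a (real-analytic) diffeomorphism onto its image $F(N)$, a real-analytic submanifold. **Proposition.** Let $N\subset\mathbb C^n$ be a connected real-analytic generic submanifold of real codimension $k\ge 2$, $U$ an open neighborhood of $N$, and $F\colon U\to\mathbb C^m$ a holomorphic map such that $F|_N$ is a diffeomorphism and $DF$ is generically of rank $n$. Suppose that $$4n-k\ \ge\ 2(m+1).$$ Then for every $p\in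 N$ and every $\delta>0$ there exist an open neighborhood $\widetilde U\subset U$ of $p$ and a holomorphic map $\widetilde F\colon\widetilde U\to\mathbb C^m$ such that $\|F-\widetilde F\|_{\widetilde U}<\delta$, $\widetilde F|_{N\cap\widetilde U}$ is a diffeomorphism, $D\widetilde F$ is generically of rank $n$, $\widetilde F(N\cap\widetilde U)$ is CR singular at $\widetilde F(p)$, and $\widetilde F$ has the following property: for every open neighborhood $W\subset\widetilde U$ of $p$ there exists $\epsilon>0$ such that, for every holomorphic $G\colon W\to\mathbb C^m$ with $\|\widetilde F-G\|_W<\epsilon$, the derivative $DG$ is not of rank $n$ somewhere on $N\cap W$, and $G(N\cap W)$ is not a CR submanifold. -/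

import Mathlib

open scoped Topology TensorProduct ENNReal

noncomputable section

namespace CRImage

/-- The space `ℂⁿ`. -/
abbrev Cn (n : ℕ) : Type := EuclideanSpace ℂ (Fin n)

/-- `M` is an (embedded) real-analytic submanifold of `ℂⁿ` of real codimension `k`: near each of its
points it is the zero set of `k` real-valued real-analytic functions with independent
differentials. -/
def IsRealAnalyticSubmanifold {n : ℕ} (k : ℕ) (M : Set (Cn n)) : Prop :=
  ∀ p ∈ M, ∃ O : Set (Cn n), IsOpen O ∧ p ∈ O ∧ ∃ ρ : Cn n → (Fin k → ℝ),
    AnalyticOnNhd ℝ ρ O ∧ (∀ z ∈ O, Function.Surjective (fderiv ℝ ρ z)) ∧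
      M ∩ O = {z ∈ O | ρ z = 0}

/-- The real tangent space `T_p M`, spanned by the velocities at `p` of curves in `M` through
`p`. -/
def tangentSpace {n : ℕ} (M : Set (Cn n)) (p : Cn n) : Submodule ℝ (Cn n) :=
  Submodule.span ℝ {v | ∃ γ : ℝ → Cn n,
    γ 0 = p ∧ (∀ᶠ t in 𝓝 (0 : ℝ), γ t ∈ M) ∧ HasDerivAt γ v 0}

/-- Multiplication by `i` on `ℂⁿ`, as a real-linear map (the complex structure `J`). -/
def mulI (n : ℕ) : Cn n →ₗ[ℝ] Cn n :=
  (Complex.I • (LinearMap.id : Cn n →ₗ[ℂ] Cn n)).restrictScalars ℝ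

/-- The space `T^{0,1}_p M` of antiholomorphic tangent vectors: the vectors of the complexified
tangent space `ℂ ⊗ T_p M` that lie in the span of `∂/∂z̄₁, …, ∂/∂z̄ₙ`. That span is the eigenspace
of `J`, extended complex-linearly to `ℂ ⊗ ℂⁿ`, for the eigenvalue `-i`. -/
def antiholTangentSpace {n : ℕ} (M : Set (Cn n)) (p : Cn n) : Submodule ℂ (ℂ ⊗[ℝ] Cn n) :=
  (tangentSpace M p).baseChange ℂ ⊓
    Module.End.eigenspace ((mulI n).baseChange ℂ) (-Complex.I)

/-- `dim T^{0,1}_p M`. -/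
def crDim {n : ℕ} (M : Set (Cn n)) (p : Cn n) : ℕ :=
  Module.finrank ℂ (antiholTangentSpace M p)

/-- `q ∈ M` is a CR point if `dim T^{0,1}_p M` is constant for `p ∈ M` near `q`. -/
def IsCRPoint {n : ℕ} (M : Set (Cn n)) (q : Cn n) : Prop :=
  q ∈ M ∧ ∃ d : ℕ, ∀ᶠ p in 𝓝[M] q, crDim M p = d

/-- `M` is a real-analytic submanifold that has a CR singularity at `q ∈ M`: the dimension
of `T^{0,1}_p M` is not constant in any neighborhood of `q` in `M`. -/
def IsCRSingularAt {n : ℕ} (M : Set (Cn n)) (q : Cn n) : Prop :=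
  (∃ k : ℕ, IsRealAnalyticSubmanifold k M) ∧ q ∈ M ∧ ¬ IsCRPoint M q

/-- `M` is a CR submanifold: a real-analytic submanifold all of whose points are CR points. (If `M`
is connected, this says that `dim T^{0,1}_p M` is constant on `M`.) -/
def IsCRSubmanifold {n : ℕ} (M : Set (Cn n)) : Prop :=
  (∃ k : ℕ, IsRealAnalyticSubmanifold k M) ∧ ∀ q ∈ M, IsCRPoint M q

/-- `N` is a generic real-analytic submanifold of `ℂⁿ` of real codimension `k`:
`T_p N + i T_p N = ℂⁿ` at each of its points `p`. -/
def IsGenericSubmanifold {n : ℕ} (k : ℕ) (N : Set (Cn n)) : Prop :=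
  IsRealAnalyticSubmanifold k N ∧
    ∀ p ∈ N, tangentSpace N p ⊔ (tangentSpace N p).map (mulI n) = ⊤

/-- The restriction of `F` to the submanifold `N` is a diffeomorphism (in the real-analytic sense)
onto its image: the image is a real-analytic submanifold, `F|_N` is real-analytic and injective,
and near each point of the image the inverse of `F|_N` is the restriction of a real-analytic
map `g`. -/
def IsDiffeoOntoImage {n m : ℕ} (F : Cn n → Cn m) (N : Set (Cn n)) : Prop :=
  (∃ k : ℕ, IsRealAnalyticSubmanifold k (F '' N)) ∧
    AnalyticOnNhd ℝ F N ∧ Set.InjOn F N ∧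
    ∀ p ∈ N, ∃ g : Cn m → Cn n, AnalyticAt ℝ g (F p) ∧
      ∀ᶠ y in 𝓝[F '' N] (F p), g y ∈ N ∧ F (g y) = y

/-- The rank of the holomorphic derivative `DF` at `z`. -/
def holRank {n m : ℕ} (F : Cn n → Cn m) (z : Cn n) : ℕ :=
  Module.finrank ℂ (LinearMap.range (fderiv ℂ F z).toLinearMap)

/-- `DF` is generically of rank `n` on `U`: it is of rank `n` on an open dense subset of `U`. -/
def GenericallyFullRank {n m : ℕ} (F : Cn n → Cn m) (U : Set (Cn n)) : Prop :=
  ∃ O : Set (Cn n), IsOpen O ∧ O ⊆ U ∧ U ⊆ closure O ∧ ∀ z ∈ O, holRank F z = n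

/-- The supremum norm `‖F - G‖_W` (possibly infinite). -/
def supDist {n m : ℕ} (W : Set (Cn n)) (F G : Cn n → Cn m) : ℝ≥0∞ :=
  ⨆ z ∈ W, ‖F z - G z‖ₑ

end CRImage

end

namespace CRImage

section RealChart

variable {E F Y : Type*} [NormedAddCommGroup E] [NormedSpace ℝ E] [FiniteDimensional ℝ E]
  [NormedAddCommGroup F] [NormedSpace ℝ F] [FiniteDimensional ℝ F]
  [NormedAddCommGroup Y] [NormedSpace ℝ Y] [FiniteDimensional ℝ Y]

/-- A zero set with surjective differential is straightened by a real-analytic chart whose first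
component factors through any map immersing it. -/
theorem exists_analytic_chart {f : E → F} {ρ : E → Y} {O : Set E} {p : E} {K : Submodule ℝ E}
    (hO : O ∈ 𝓝 p) (hf : AnalyticAt ℝ f p) (hρ : AnalyticAt ℝ ρ p)
    (hsurj : Function.Surjective (fderiv ℝ ρ p)) (hK : ∀ u, u ∈ K ↔ fderiv ℝ ρ p u = 0)
    (hinj : ∀ u ∈ K, fderiv ℝ f p u = 0 → u = 0) :
    ∃ (Λ : F →L[ℝ] K) (Φ : OpenPartialHomeomorph E (K × Y)),
      p ∈ Φ.source ∧ Φ.source ⊆ O ∧ (∀ z, Φ z = (Λ (f z), ρ z)) ∧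
      AnalyticOnNhd ℝ Φ.symm Φ.target ∧ ∀ u : K, Λ (fderiv ℝ f p u) = u := by
  obtain ⟨Λ₀, hΛ₀⟩ := LinearMap.exists_leftInverse_of_injective
    ((fderiv ℝ f p).toLinearMap ∘ₗ K.subtype) (by
      rw [LinearMap.ker_eq_bot']
      intro u hu
      exact Subtype.ext (hinj u u.2 hu))
  set Λ : F →L[ℝ] K := LinearMap.toContinuousLinearMap Λ₀ with hΛdef
  have hΛ : ∀ u : K, Λ (fderiv ℝ f p u) = u := fun u => LinearMap.congr_fun hΛ₀ u
  set φ : E → K × Y := fun z => (Λ (f z), ρ z) with hφ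
  have han : AnalyticAt ℝ φ p := ((Λ.analyticAt _).comp hf).prod hρ
  have hder : fderiv ℝ φ p = (Λ ∘L fderiv ℝ f p).prod (fderiv ℝ ρ p) := by
    refine HasFDerivAt.fderiv (HasFDerivAt.prodMk ?_ hρ.differentiableAt.hasFDerivAt)
    exact Λ.hasFDerivAt.comp p hf.differentiableAt.hasFDerivAt
  have hKker : K = (fderiv ℝ ρ p).toLinearMap.ker := by
    ext u; simp [hK]
  have hdim : Module.finrank ℝ E = Module.finrank ℝ (K × Y) := by
    have h1 := (fderiv ℝ ρ p).toLinearMap.finrank_range_add_finrank_ker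
    rw [LinearMap.range_eq_top.2 hsurj, finrank_top, ← hKker] at h1
    rw [Module.finrank_prod]; omega
  have hinjφ : Function.Injective (fderiv ℝ φ p).toLinearMap := by
    rw [← LinearMap.ker_eq_bot, LinearMap.ker_eq_bot']
    intro u hu
    rw [hder] at hu
    have h2 : fderiv ℝ ρ p u = 0 := congrArg Prod.snd hu
    have h1 : Λ (fderiv ℝ f p u) = 0 := congrArg Prod.fst hu
    have h3 := hΛ ⟨u, (hK u).2 h2⟩
    rw [h1] at h3
    exact (congrArg Subtype.val h3).symm
  set e : E ≃L[ℝ] (K × Y) :=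
    (LinearEquiv.ofInjectiveOfFinrankEq _ hinjφ hdim).toContinuousLinearEquiv with he
  have heφ : (e : E →L[ℝ] K × Y) = fderiv ℝ φ p := by ext u <;> rfl
  have hstrict : HasStrictFDerivAt φ (e : E →L[ℝ] K × Y) p := by
    rw [heφ]; exact han.hasStrictFDerivAt
  have hev : ∀ᶠ z in 𝓝 p, z ∈ O ∧ AnalyticAt ℝ φ z ∧
      fderiv ℝ φ z ∈ Set.range ((↑) : (E ≃L[ℝ] K × Y) → E →L[ℝ] K × Y) := by
    refine Filter.Eventually.and hO (han.eventually_analyticAt.and ?_)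
    have hc : ContinuousAt (fderiv ℝ φ) p := han.fderiv.continuousAt
    refine hc.eventually ?_
    rw [← heφ]
    exact ContinuousLinearEquiv.nhds e
  obtain ⟨O', hO'sub, hO', hpO'⟩ := mem_nhds_iff.1 hev
  refine ⟨Λ, (hstrict.toOpenPartialHomeomorph φ).restrOpen O' hO', ?_, ?_, ?_, ?_, hΛ⟩
  · exact ⟨hstrict.mem_toOpenPartialHomeomorph_source, hpO'⟩
  · rintro z ⟨-, hz⟩
    exact (hO'sub hz).1
  · intro z; rfl
  · intro y hy
    set Ψ := (hstrict.toOpenPartialHomeomorph φ).restrOpen O' hO' with hΨ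
    have hz := Ψ.map_target hy
    obtain ⟨-, h2, i, hi⟩ := hO'sub hz.2
    have := Ψ.analyticAt_symm' hz h2 hi.symm
    rwa [Ψ.right_inv hy] at this

/-- The velocities at `p` of curves in the zero set of a submersion `ρ` are the vectors killed by
its differential. -/
theorem exists_curve_iff_fderiv_eq_zero {ρ : E → Y} {O M : Set E} {p : E}
    (hO : IsOpen O) (hp : p ∈ O) (hρ : AnalyticAt ℝ ρ p)
    (hsurj : Function.Surjective (fderiv ℝ ρ p)) (hpM : p ∈ M)
    (hM : M ∩ O = {z ∈ O | ρ z = 0}) (v : E) :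
    (∃ γ : ℝ → E, γ 0 = p ∧ (∀ᶠ t in 𝓝 (0 : ℝ), γ t ∈ M) ∧ HasDerivAt γ v 0) ↔
      fderiv ℝ ρ p v = 0 := by
  have hmem : ∀ z ∈ O, (z ∈ M ↔ ρ z = 0) := fun z hz => by
    have := Set.ext_iff.1 hM z
    simpa [hz] using this
  constructor
  · rintro ⟨γ, h0, hev, hd⟩
    have h1 : HasDerivAt (fun t => ρ (γ t)) (fderiv ℝ ρ p v) 0 := by
      have : HasFDerivAt ρ (fderiv ℝ ρ p) (γ 0) := by
        rw [h0]; exact hρ.differentiableAt.hasFDerivAt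
      exact this.comp_hasDerivAt 0 hd
    have h2 : (fun t => ρ (γ t)) =ᶠ[𝓝 0] fun _ => (0 : Y) := by
      have hO' : ∀ᶠ t in 𝓝 (0 : ℝ), γ t ∈ O :=
        hd.continuousAt.eventually (by rw [h0]; exact hO.mem_nhds hp)
      filter_upwards [hev, hO'] with t ht ht'
      exact (hmem _ ht').1 ht
    exact h1.unique ((hasDerivAt_const (0 : ℝ) (0 : Y)).congr_of_eventuallyEq h2)
  · intro hv
    set K : Submodule ℝ E := (fderiv ℝ ρ p).toLinearMap.ker with hKdef
    have hid : fderiv ℝ (fun z : E => z) p = ContinuousLinearMap.id ℝ E := fderiv_fun_id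
    obtain ⟨Λ, Φ, hpΦ, hΦO, hΦ, hsymm, hΛ⟩ := exists_analytic_chart (f := fun z : E => z)
      (K := K) (hO.mem_nhds hp) analyticAt_id hρ hsurj (fun u => by simp [hKdef])
      (by intro u _ hu; rw [hid] at hu; exact hu)
    have hpt : Φ p ∈ Φ.target := Φ.map_source hpΦ
    have hdΦ : HasFDerivAt Φ ((Λ : E →L[ℝ] K).prod (fderiv ℝ ρ p)) p := by
      have : (Φ : E → K × Y) = fun z => (Λ z, ρ z) := funext hΦ
      rw [this]
      exact Λ.hasFDerivAt.prodMk hρ.differentiableAt.hasFDerivAt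
    have hdS := (hsymm _ hpt).differentiableAt.hasFDerivAt
    have hcomp : (fderiv ℝ Φ.symm (Φ p)) ∘L ((Λ : E →L[ℝ] K).prod (fderiv ℝ ρ p))
        = ContinuousLinearMap.id ℝ E := by
      refine (hdS.comp p hdΦ).unique ((hasFDerivAt_id p).congr_of_eventuallyEq ?_)
      filter_upwards [Φ.open_source.mem_nhds hpΦ] with z hz
      exact Φ.left_inv hz
    set w : K × Y := (Λ v, 0) with hw
    have hwv : fderiv ℝ Φ.symm (Φ p) w = v := by
      have := DFunLike.congr_fun hcomp v
      simpa [hv] using this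
    have hline : HasDerivAt (fun t : ℝ => Φ p + t • w) w 0 := by
      simpa using ((hasDerivAt_id (0 : ℝ)).smul_const w).const_add (Φ p)
    refine ⟨fun t => Φ.symm (Φ p + t • w), by simp [Φ.left_inv hpΦ], ?_, ?_⟩
    · have htt : ∀ᶠ t in 𝓝 (0 : ℝ), Φ p + t • w ∈ Φ.target :=
        hline.continuousAt.eventually (by simpa using Φ.open_target.mem_nhds hpt)
      filter_upwards [htt] with t ht
      rw [hmem _ (hΦO (Φ.map_target ht))]
      have h1 := Φ.right_inv ht
      rw [hΦ] at h1
      have h2 := congrArg Prod.snd h1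
      have h3 : ρ p = 0 := (hmem p hp).1 hpM
      simpa [hΦ p, hw, h3] using h2
    · have h0 : HasFDerivAt Φ.symm (fderiv ℝ Φ.symm (Φ p)) (Φ p + (0 : ℝ) • w) := by
        simpa using hdS
      have := h0.comp_hasDerivAt 0 hline
      rwa [hwv] at this

/-- Near a point, the zero set of a submersion has arbitrarily small connected relative
neighbourhoods. -/
theorem exists_isPreconnected_nhdsWithin {ρ : E → Y} {O M V : Set E} {p : E}
    (hO : IsOpen O) (hp : p ∈ O) (hρ : AnalyticAt ℝ ρ p)
    (hsurj : Function.Surjective (fderiv ℝ ρ p)) (hpM : p ∈ M)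
    (hM : M ∩ O = {z ∈ O | ρ z = 0}) (hV : V ∈ 𝓝 p) :
    ∃ S ⊆ M ∩ V, IsPreconnected S ∧ S ∈ 𝓝[M] p := by
  have hmem : ∀ z ∈ O, (z ∈ M ↔ ρ z = 0) := fun z hz => by
    have := Set.ext_iff.1 hM z
    simpa [hz] using this
  set K : Submodule ℝ E := (fderiv ℝ ρ p).toLinearMap.ker with hKdef
  have hid : fderiv ℝ (fun z : E => z) p = ContinuousLinearMap.id ℝ E := fderiv_fun_id
  obtain ⟨Λ, Φ, hpΦ, hΦO, hΦ, hsymm, hΛ⟩ := exists_analytic_chart (f := fun z : E => z)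
    (K := K) (hO.mem_nhds hp) analyticAt_id hρ hsurj (fun u => by simp [hKdef])
    (by intro u _ hu; rw [hid] at hu; exact hu)
  have hpt : Φ p ∈ Φ.target := Φ.map_source hpΦ
  have hp0 : Φ p = (Λ p, 0) := by rw [hΦ, (hmem p hp).1 hpM]
  have hcont : ContinuousAt Φ.symm (Φ p) := (hsymm _ hpt).continuousAt
  have hnb : Φ.target ∩ Φ.symm ⁻¹' V ∈ 𝓝 (Φ p) := by
    refine Filter.inter_mem (Φ.open_target.mem_nhds hpt) (hcont ?_)
    rwa [Φ.left_inv hpΦ]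
  obtain ⟨s, hs, hball⟩ := Metric.mem_nhds_iff.1 hnb
  set T : Set (K × Y) := Metric.ball (Λ p) s ×ˢ {0} with hT
  have hTsub : T ⊆ Metric.ball (Φ p) s := by
    rintro ⟨a, b⟩ ⟨ha, hb⟩
    rw [Set.mem_singleton_iff] at hb
    simp only at hb ha
    rw [hp0, Metric.mem_ball, hb, Prod.dist_eq]
    simpa [hs] using ha
  refine ⟨Φ.symm '' T, ?_, ?_, ?_⟩
  · rintro _ ⟨y, hy, rfl⟩
    have hy' := hball (hTsub hy)
    refine ⟨?_, hy'.2⟩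
    rw [hmem _ (hΦO (Φ.map_target hy'.1))]
    have h1 := Φ.right_inv hy'.1
    rw [hΦ] at h1
    exact (congrArg Prod.snd h1).trans hy.2
  · refine IsPreconnected.image ?_ _ ?_
    · exact ((convex_ball _ _).prod (convex_singleton _)).isPreconnected
    · exact Φ.continuousOn_symm.mono fun y hy => (hball (hTsub hy)).1
  · have hΦc : ContinuousAt (fun z : E => Λ z) p := Λ.continuous.continuousAt
    have h1 : ∀ᶠ z in 𝓝 p, Λ z ∈ Metric.ball (Λ p) s :=
      hΦc (Metric.ball_mem_nhds _ hs)
    rw [mem_nhdsWithin_iff_eventually]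
    filter_upwards [h1, Φ.open_source.mem_nhds hpΦ] with z hz hzs hzM
    refine ⟨Φ z, ?_, Φ.left_inv hzs⟩
    rw [hΦ]
    exact ⟨hz, (hmem z (hΦO hzs)).1 hzM⟩

/-- The zero set of a submersion has local Hausdorff dimension at most the dimension of the kernel
of its differential. -/
theorem exists_nhdsWithin_dimH_le {ρ : E → Y} {O M : Set E} {p : E}
    (hO : IsOpen O) (hp : p ∈ O) (hρ : AnalyticAt ℝ ρ p)
    (hsurj : Function.Surjective (fderiv ℝ ρ p))
    (hM : M ∩ O = {z ∈ O | ρ z = 0}) :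
    ∃ S ∈ 𝓝[M] p, dimH S ≤ Module.finrank ℝ (fderiv ℝ ρ p).toLinearMap.ker := by
  have hmem : ∀ z ∈ O, (z ∈ M ↔ ρ z = 0) := fun z hz => by
    have := Set.ext_iff.1 hM z
    simpa [hz] using this
  set K : Submodule ℝ E := (fderiv ℝ ρ p).toLinearMap.ker with hKdef
  have hid : fderiv ℝ (fun z : E => z) p = ContinuousLinearMap.id ℝ E := fderiv_fun_id
  obtain ⟨Λ, Φ, hpΦ, hΦO, hΦ, hsymm, hΛ⟩ := exists_analytic_chart (f := fun z : E => z)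
    (K := K) (hO.mem_nhds hp) analyticAt_id hρ hsurj (fun u => by simp [hKdef])
    (by intro u _ hu; rw [hid] at hu; exact hu)
  have hemb : Isometry (fun x : K => ((x, 0) : K × Y)) :=
    Isometry.of_dist_eq fun x y => by simp [Prod.dist_eq]
  refine ⟨Φ.symm '' ((fun x : K => ((x, 0) : K × Y)) '' (Set.univ) ∩ Φ.target), ?_, ?_⟩
  · rw [mem_nhdsWithin_iff_eventually]
    filter_upwards [Φ.open_source.mem_nhds hpΦ] with z hzs hzM
    refine ⟨Φ z, ⟨⟨Λ z, trivial, ?_⟩, Φ.map_source hzs⟩, Φ.left_inv hzs⟩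
    rw [hΦ, (hmem z (hΦO hzs)).1 hzM]
  · calc _ ≤ dimH ((fun x : K => ((x, 0) : K × Y)) '' (Set.univ) ∩ Φ.target) := by
          refine dimH_image_le_of_locally_lipschitzOn fun y hy => ?_
          obtain ⟨C, t, ht, hL⟩ := ((hsymm y hy.2).contDiffAt (n := 1)).exists_lipschitzOnWith
          exact ⟨C, t, mem_nhdsWithin_of_mem_nhds ht, hL⟩
      _ ≤ dimH ((fun x : K => ((x, 0) : K × Y)) '' (Set.univ)) := dimH_mono Set.inter_subset_left
      _ = dimH (Set.univ : Set K) := hemb.dimH_image _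
      _ = _ := Real.dimH_univ_eq_finrank _

/-- The zero set of a submersion has Hausdorff dimension at least the dimension of the kernel of
its differential. -/
theorem finrank_ker_le_dimH {ρ : E → Y} {O M : Set E} {p : E}
    (hO : IsOpen O) (hp : p ∈ O) (hρ : AnalyticAt ℝ ρ p)
    (hsurj : Function.Surjective (fderiv ℝ ρ p)) (hpM : p ∈ M)
    (hM : M ∩ O = {z ∈ O | ρ z = 0}) :
    (Module.finrank ℝ (fderiv ℝ ρ p).toLinearMap.ker : ℝ≥0∞) ≤ dimH M := by
  have hmem : ∀ z ∈ O, (z ∈ M ↔ ρ z = 0) := fun z hz => by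
    have := Set.ext_iff.1 hM z
    simpa [hz] using this
  set K : Submodule ℝ E := (fderiv ℝ ρ p).toLinearMap.ker with hKdef
  have hid : fderiv ℝ (fun z : E => z) p = ContinuousLinearMap.id ℝ E := fderiv_fun_id
  obtain ⟨Λ, Φ, hpΦ, hΦO, hΦ, hsymm, hΛ⟩ := exists_analytic_chart (f := fun z : E => z)
    (K := K) (hO.mem_nhds hp) analyticAt_id hρ hsurj (fun u => by simp [hKdef])
    (by intro u _ hu; rw [hid] at hu; exact hu)
  have hpt : Φ p ∈ Φ.target := Φ.map_source hpΦ
  have hp0 : Φ p = (Λ p, 0) := by rw [hΦ, (hmem p hp).1 hpM]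
  have hnb : Λ '' M ∈ 𝓝 (Λ p) := by
    have h1 : ∀ᶠ x in 𝓝 (Λ p), ((x, 0) : K × Y) ∈ Φ.target := by
      have hc : ContinuousAt (fun x : K => ((x, 0) : K × Y)) (Λ p) := by fun_prop
      refine hc (Φ.open_target.mem_nhds ?_)
      rwa [hp0] at hpt
    filter_upwards [h1] with x hx
    have h1 := Φ.right_inv hx
    rw [hΦ] at h1
    exact ⟨Φ.symm (x, 0), (hmem _ (hΦO (Φ.map_target hx))).2 (congrArg Prod.snd h1),
      congrArg Prod.fst h1⟩
  calc _ = dimH (Λ '' M) := (Real.dimH_of_mem_nhds hnb).symm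
    _ ≤ dimH M := Λ.lipschitz.dimH_image_le M

/-- A set that is locally of Hausdorff dimension at most `d` is of Hausdorff dimension at most
`d`. -/
theorem dimH_le_of_locally {X : Type*} [EMetricSpace X] [SecondCountableTopology X] {s : Set X}
    {d : ℝ≥0∞} (h : ∀ x ∈ s, ∃ t ∈ 𝓝[s] x, dimH t ≤ d) : dimH s ≤ d := by
  by_contra! hlt
  obtain ⟨x, hx, h'⟩ := exists_mem_nhdsWithin_lt_dimH_of_lt_dimH hlt
  obtain ⟨t, ht, hd⟩ := h x hx
  exact absurd (h' t ht) (not_lt.2 hd)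

end RealChart

section LinearAlgebra

@[simp]
theorem mulI_apply {n : ℕ} (x : Cn n) : mulI n x = Complex.I • x := rfl

theorem finrank_real_Cn (n : ℕ) : Module.finrank ℝ (Cn n) = 2 * n := by
  rw [finrank_real_of_complex, finrank_euclideanSpace_fin]

/-- Every element of a complexification is `1 ⊗ a + i ⊗ b` for unique `a` and `b`. -/
theorem exists_add_I_tmul_of_mem_baseChange {V : Type*} [AddCommGroup V] [Module ℝ V]
    (T : Submodule ℝ V) {x : ℂ ⊗[ℝ] V} (hx : x ∈ T.baseChange ℂ) :
    ∃ a ∈ T, ∃ b ∈ T, x = (1 : ℂ) ⊗ₜ[ℝ] a + Complex.I ⊗ₜ[ℝ] b := by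
  rw [Submodule.baseChange_eq_span] at hx
  induction hx using Submodule.span_induction with
  | mem x h =>
    obtain ⟨a, ha, rfl⟩ := h
    exact ⟨a, ha, 0, T.zero_mem, by simp⟩
  | zero => exact ⟨0, T.zero_mem, 0, T.zero_mem, by simp⟩
  | add x y _ _ hx hy =>
    obtain ⟨a, ha, b, hb, rfl⟩ := hx
    obtain ⟨c, hc, d, hd, rfl⟩ := hy
    exact ⟨a + c, T.add_mem ha hc, b + d, T.add_mem hb hd, by
      simp only [TensorProduct.tmul_add]; abel⟩
  | smul z x _ hx =>
    obtain ⟨a, ha, b, hb, rfl⟩ := hx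
    refine ⟨z.re • a - z.im • b, T.sub_mem (T.smul_mem _ ha) (T.smul_mem _ hb),
      z.re • b + z.im • a, T.add_mem (T.smul_mem _ hb) (T.smul_mem _ ha), ?_⟩
    have h1 : z = z.re • (1 : ℂ) + z.im • Complex.I := by
      apply Complex.ext <;> simp
    have h2 : z * Complex.I = z.re • Complex.I - z.im • (1 : ℂ) := by
      apply Complex.ext <;> simp
    rw [smul_add, TensorProduct.smul_tmul', TensorProduct.smul_tmul', smul_eq_mul, smul_eq_mul,
      mul_one, h2]
    nth_rewrite 1 [h1]
    simp only [TensorProduct.tmul_add, TensorProduct.tmul_sub, TensorProduct.add_tmul,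
      TensorProduct.sub_tmul, TensorProduct.smul_tmul]
    abel

theorem one_tmul_add_I_tmul_inj {V : Type*} [AddCommGroup V] [Module ℝ V] {a b c d : V}
    (h : (1 : ℂ) ⊗ₜ[ℝ] a + Complex.I ⊗ₜ[ℝ] b = (1 : ℂ) ⊗ₜ[ℝ] c + Complex.I ⊗ₜ[ℝ] d) :
    a = c ∧ b = d := by
  constructor
  · have := congrArg (TensorProduct.lid ℝ V ∘ LinearMap.rTensor V Complex.reLm) h
    simpa using this
  · have := congrArg (TensorProduct.lid ℝ V ∘ LinearMap.rTensor V Complex.imLm) h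
    simpa using this

/-- The CR dimension is the complex dimension of the maximal complex tangent subspace. -/
theorem two_mul_crDim {n : ℕ} (M : Set (Cn n)) (p : Cn n) :
    2 * crDim M p =
      Module.finrank ℝ ↥(tangentSpace M p ⊓ (tangentSpace M p).map (mulI n)) := by
  set T := tangentSpace M p with hT
  rw [crDim, ← finrank_real_of_complex]
  have hmem : ∀ a, a ∈ T ⊓ T.map (mulI n) ↔ a ∈ T ∧ Complex.I • a ∈ T := by
    intro a
    rw [Submodule.mem_inf, Submodule.mem_map]
    refine and_congr_right fun _ => ⟨?_, fun h => ⟨-(Complex.I • a), T.neg_mem h, ?_⟩⟩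
    · rintro ⟨b, hb, rfl⟩
      have : Complex.I • mulI n b = -b := by simp [smul_smul]
      rw [this]
      exact T.neg_mem hb
    · simp [smul_smul]
  set f : Cn n →ₗ[ℝ] ℂ ⊗[ℝ] Cn n :=
    TensorProduct.mk ℝ ℂ (Cn n) 1 + (TensorProduct.mk ℝ ℂ (Cn n) Complex.I) ∘ₗ mulI n with hf
  have hfa : ∀ a, f a = (1 : ℂ) ⊗ₜ[ℝ] a + Complex.I ⊗ₜ[ℝ] (Complex.I • a) := fun a => rfl
  have hfinj : Function.Injective f := fun a b hab => by
    rw [hfa, hfa] at hab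
    exact (one_tmul_add_I_tmul_inj hab).1
  have hmap : (T ⊓ T.map (mulI n)).map f = (antiholTangentSpace M p).restrictScalars ℝ := by
    ext x
    rw [Submodule.mem_map, Submodule.restrictScalars_mem, antiholTangentSpace, Submodule.mem_inf,
      Module.End.mem_eigenspace_iff]
    constructor
    · rintro ⟨a, ha, rfl⟩
      obtain ⟨h1, h2⟩ := (hmem a).1 ha
      rw [hfa]
      refine ⟨Submodule.add_mem _ (Submodule.tmul_mem_baseChange_of_mem _ h1)
        (Submodule.tmul_mem_baseChange_of_mem _ h2), ?_⟩
      simp [TensorProduct.smul_tmul', smul_smul, TensorProduct.tmul_neg, TensorProduct.neg_tmul]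
      abel
    · rintro ⟨h1, h2⟩
      obtain ⟨a, ha, b, hb, rfl⟩ := exists_add_I_tmul_of_mem_baseChange T h1
      have h3 : (1 : ℂ) ⊗ₜ[ℝ] (Complex.I • a) + Complex.I ⊗ₜ[ℝ] (Complex.I • b)
          = (1 : ℂ) ⊗ₜ[ℝ] b + Complex.I ⊗ₜ[ℝ] (-a) := by
        simp only [map_add, LinearMap.baseChange_tmul, mulI_apply, smul_add,
          TensorProduct.smul_tmul', smul_eq_mul, neg_mul, Complex.I_mul_I, mul_one, neg_neg] at h2
        rw [h2, TensorProduct.tmul_neg, TensorProduct.neg_tmul]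
        abel
      have h4 := (one_tmul_add_I_tmul_inj h3).1
      refine ⟨a, (hmem a).2 ⟨ha, h4 ▸ hb⟩, ?_⟩
      rw [hfa, h4]
  have h5 := (Submodule.equivMapOfInjective f hfinj (T ⊓ T.map (mulI n))).finrank_eq
  rw [h5, hmap]
  rfl

/-- If the tangent space of `M` is the isomorphic image of a generic subspace under a
complex-linear map, the CR dimension of `M` is determined by the rank of that map. -/
theorem crDim_add_finrank_range {n m : ℕ} {T : Submodule ℝ (Cn n)} {M : Set (Cn m)} {q : Cn m}
    (L : Cn n →L[ℂ] Cn m) (hT : T ⊔ T.map (mulI n) = ⊤)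
    (hM : tangentSpace M q = T.map (L.toLinearMap.restrictScalars ℝ))
    (hinj : ∀ u ∈ T, L u = 0 → u = 0) :
    crDim M q + Module.finrank ℂ (LinearMap.range L.toLinearMap) = Module.finrank ℝ T := by
  set Lr : Cn n →ₗ[ℝ] Cn m := L.toLinearMap.restrictScalars ℝ with hLr
  set R := T.map Lr with hR
  have hcomm : R.map (mulI m) = (T.map (mulI n)).map Lr := by
    rw [hR, ← Submodule.map_comp, ← Submodule.map_comp]
    congr 1
    ext1 x
    exact (L.map_smul Complex.I x).symm
  have hsup : R ⊔ R.map (mulI m) = (LinearMap.range L.toLinearMap).restrictScalars ℝ := by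
    rw [hcomm, hR, ← Submodule.map_sup, hT, Submodule.map_top]
    rfl
  have hfR : Module.finrank ℝ R = Module.finrank ℝ T := by
    have hinj' : Function.Injective (Lr.domRestrict T) := by
      rw [← LinearMap.ker_eq_bot, LinearMap.ker_eq_bot']
      exact fun u hu => Subtype.ext (hinj u u.2 hu)
    rw [hR, ← LinearMap.range_domRestrict]
    exact LinearMap.finrank_range_of_inj hinj'
  have hfJ : Module.finrank ℝ (R.map (mulI m)) = Module.finrank ℝ R := by
    refine (Submodule.equivMapOfInjective (mulI m) ?_ R).finrank_eq.symm
    intro x y hxy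
    exact smul_right_injective _ Complex.I_ne_zero hxy
  have h1 := Submodule.finrank_sup_add_finrank_inf_eq R (R.map (mulI m))
  have h2 : Module.finrank ℝ ↥((LinearMap.range L.toLinearMap).restrictScalars ℝ) =
      2 * Module.finrank ℂ (LinearMap.range L.toLinearMap) :=
    finrank_real_of_complex (LinearMap.range L.toLinearMap)
  have h3 := two_mul_crDim M q
  rw [hM] at h3
  rw [hsup, h2, ← h3, hfJ, hfR] at h1
  omega

/-- A generic subspace of codimension at least two avoids some complex line. -/
theorem exists_complex_line_disjoint {n k : ℕ} {T : Submodule ℝ (Cn n)}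
    (hT : T ⊔ T.map (mulI n) = ⊤) (hdim : Module.finrank ℝ T + k = 2 * n) (hk : 2 ≤ k) :
    ∃ v : Cn n, v ≠ 0 ∧ ∀ c : ℂ, c • v ∈ T → c = 0 := by
  have hfJ : Module.finrank ℝ (T.map (mulI n)) = Module.finrank ℝ T := by
    refine (Submodule.equivMapOfInjective (mulI n) ?_ T).finrank_eq.symm
    intro x y hxy
    exact smul_right_injective _ Complex.I_ne_zero hxy
  have h1 := Submodule.finrank_sup_add_finrank_inf_eq T (T.map (mulI n))
  rw [hT, finrank_top, finrank_real_Cn, hfJ] at h1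
  set H := T ⊓ T.map (mulI n) with hH
  have hIH : ∀ x ∈ T, Complex.I • x ∈ T → x ∈ H := fun x hx hIx =>
    ⟨hx, -(Complex.I • x), T.neg_mem hIx, by simp [smul_smul]⟩
  obtain ⟨t₁, ht₁, ht₁H⟩ : ∃ t ∈ T, t ∉ H := by
    by_contra! hcon
    have := Submodule.finrank_mono (R := ℝ) (show T ≤ H from hcon)
    omega
  obtain ⟨t₂, ht₂, ht₂H⟩ : ∃ t ∈ T, t ∉ H ⊔ Submodule.span ℝ {t₁} := by
    by_contra! hcon
    have h2 := Submodule.finrank_mono (R := ℝ) (show T ≤ H ⊔ Submodule.span ℝ {t₁} from hcon)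
    have h3 := Submodule.finrank_add_le_finrank_add_finrank H (Submodule.span ℝ {t₁})
    have h4 := finrank_span_le_card (R := ℝ) ({t₁} : Set (Cn n))
    simp at h4
    omega
  have hindep : ∀ a b : ℝ, a • t₁ + b • t₂ ∈ H → a = 0 ∧ b = 0 := by
    intro a b hab
    have hb : b = 0 := by
      by_contra hb
      apply ht₂H
      have : t₂ = b⁻¹ • (a • t₁ + b • t₂) + (-(b⁻¹ * a)) • t₁ := by
        rw [smul_add, smul_smul, smul_smul, inv_mul_cancel₀ hb, one_smul, neg_smul]; abel
      rw [this]
      exact Submodule.add_mem_sup (H.smul_mem _ hab)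
        (Submodule.smul_mem _ _ (Submodule.mem_span_singleton_self _))
    subst hb
    refine ⟨?_, rfl⟩
    by_contra ha
    apply ht₁H
    have : t₁ = a⁻¹ • (a • t₁ + (0 : ℝ) • t₂) := by
      rw [zero_smul, add_zero, smul_smul, inv_mul_cancel₀ ha, one_smul]
    rw [this]
    exact H.smul_mem _ hab
  have key : ∀ c : ℂ, c • (t₁ + Complex.I • t₂) ∈ T → c = 0 := by
    intro c hc
    have h2 : c • (t₁ + Complex.I • t₂)
        = (c.re • t₁ - c.im • t₂) + Complex.I • (c.im • t₁ + c.re • t₂) := by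
      ext i
      apply Complex.ext <;> simp <;> ring
    rw [h2] at hc
    have h3 : Complex.I • (c.im • t₁ + c.re • t₂) ∈ T :=
      (T.add_mem_iff_right (T.sub_mem (T.smul_mem _ ht₁) (T.smul_mem _ ht₂))).1 hc
    obtain ⟨h4, h5⟩ := hindep _ _
      (hIH _ (T.add_mem (T.smul_mem _ ht₁) (T.smul_mem _ ht₂)) h3)
    exact Complex.ext h5 h4
  refine ⟨t₁ + Complex.I • t₂, fun h0 => ?_, key⟩
  exact one_ne_zero (key 1 (by rw [h0, smul_zero]; exact T.zero_mem))

/-- On a real subspace of dimension at least two, some complex functional takes all values. -/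
theorem exists_functional_surjOn {V : Type*} [AddCommGroup V] [Module ℂ V] [Module ℝ V]
    [IsScalarTower ℝ ℂ V] [FiniteDimensional ℂ V] [FiniteDimensional ℝ V] {T : Submodule ℝ V}
    (hT : 2 ≤ Module.finrank ℝ T) : ∃ ℓ : V →ₗ[ℂ] ℂ, ∀ c : ℂ, ∃ t ∈ T, ℓ t = c := by
  have hT0 : T ≠ ⊥ := by rintro rfl; simp at hT
  obtain ⟨t₁, ht₁, h0⟩ := T.ne_bot_iff.1 hT0
  obtain ⟨t₂, ht₂, hs⟩ : ∃ t ∈ T, t ∉ Submodule.span ℝ {t₁} := by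
    by_contra! hcon
    have h2 := Submodule.finrank_mono (R := ℝ) (show T ≤ Submodule.span ℝ {t₁} from hcon)
    have h4 := finrank_span_le_card (R := ℝ) ({t₁} : Set V)
    simp at h4
    omega
  obtain ⟨g, hg⟩ := Module.Projective.exists_dual_eq_one ℂ h0
  obtain ⟨ℓ, h1, h2⟩ : ∃ ℓ : V →ₗ[ℂ] ℂ, ℓ t₁ = 1 ∧ (ℓ t₂).im ≠ 0 := by
    by_cases hc : t₂ ∈ Submodule.span ℂ {t₁}
    · obtain ⟨c, rfl⟩ := Submodule.mem_span_singleton.1 hc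
      refine ⟨g, hg, fun him => hs ?_⟩
      rw [map_smul, hg, smul_eq_mul, mul_one] at him
      refine Submodule.mem_span_singleton.2 ⟨c.re, ?_⟩
      have : c = (c.re : ℂ) := Complex.ext rfl (by simpa using him)
      exact (algebraMap_smul ℂ c.re t₁).symm.trans (congrArg (· • t₁) this.symm)
    · obtain ⟨f, hf, hf'⟩ := Submodule.exists_dual_map_eq_bot_of_notMem hc inferInstance
      have hf1 : f t₁ = 0 := by
        have : f t₁ ∈ (Submodule.span ℂ {t₁}).map f :=
          Submodule.mem_map_of_mem (Submodule.mem_span_singleton_self _)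
        rwa [hf', Submodule.mem_bot] at this
      refine ⟨g + ((Complex.I - g t₂) / f t₂) • f, by simp [hg, hf1], ?_⟩
      simp [div_mul_cancel₀ _ hf]
  refine ⟨ℓ, fun c => ⟨(c.re - c.im / (ℓ t₂).im * (ℓ t₂).re) • t₁ + (c.im / (ℓ t₂).im) • t₂,
    T.add_mem (T.smul_mem _ ht₁) (T.smul_mem _ ht₂), ?_⟩⟩
  rw [map_add, LinearMap.map_smul_of_tower, LinearMap.map_smul_of_tower, h1]
  apply Complex.ext
  · simp
  · simp [div_mul_cancel₀ _ h2]

/-- A real subspace of dimension at least `2 r` is mapped onto `ℂʳ` by some complex-linear map. -/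
theorem exists_linearMap_surjOn {V : Type*} [AddCommGroup V] [Module ℂ V] [Module ℝ V]
    [IsScalarTower ℝ ℂ V] [FiniteDimensional ℂ V] [FiniteDimensional ℝ V] (r : ℕ) :
    ∀ T : Submodule ℝ V, 2 * r ≤ Module.finrank ℝ T →
      ∃ ℓ : V →ₗ[ℂ] (Fin r → ℂ), ∀ c, ∃ t ∈ T, ℓ t = c := by
  induction r with
  | zero => exact fun T _ => ⟨0, fun c => ⟨0, T.zero_mem, Subsingleton.elim _ _⟩⟩
  | succ r ih =>
    intro T hT
    obtain ⟨ℓ₁, hℓ₁⟩ := exists_functional_surjOn (T := T) (by omega)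
    set φ : T →ₗ[ℝ] ℂ := (ℓ₁.restrictScalars ℝ).domRestrict T with hφ
    have hrk := φ.finrank_range_add_finrank_ker
    have hsurj : Function.Surjective φ := fun c => by
      obtain ⟨t, ht, h⟩ := hℓ₁ c
      exact ⟨⟨t, ht⟩, h⟩
    rw [LinearMap.range_eq_top.2 hsurj, finrank_top, Complex.finrank_real_complex] at hrk
    set T' := (LinearMap.ker φ).map T.subtype with hT'
    have hT'dim : Module.finrank ℝ T' = Module.finrank ℝ (LinearMap.ker φ) :=
      (Submodule.equivMapOfInjective _ T.subtype_injective _).finrank_eq.symm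
    obtain ⟨ℓ', hℓ'⟩ := ih T' (by omega)
    refine ⟨LinearMap.pi (Fin.cons ℓ₁ fun i => LinearMap.proj i ∘ₗ ℓ'), fun c => ?_⟩
    obtain ⟨t, ht, h1⟩ := hℓ₁ (c 0)
    obtain ⟨s, hs, h2⟩ := hℓ' (fun i => c i.succ - ℓ' t i)
    obtain ⟨s', hs', rfl⟩ := hs
    have hs0 : ℓ₁ (s' : V) = 0 := hs'
    refine ⟨t + s', T.add_mem ht s'.2, ?_⟩
    funext i
    refine Fin.cases ?_ (fun j => ?_) i
    · simp [h1, hs0]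
    · have := congrFun h2 j
      simp only [Submodule.subtype_apply] at this
      simp [this]

/-- `ℂᵐ` splits as the sum of `ℂⁿ` modulo a line and of `ℂʳ`, when `m + 1 = n + r`. -/
theorem exists_splitting {n m r : ℕ} (hr : m + 1 = n + r) {v : Cn n} (hv : v ≠ 0) :
    ∃ (A : Cn n →L[ℂ] Cn m) (B : (Fin r → ℂ) →L[ℂ] Cn m),
      (∀ u c, A u + B c = 0 ↔ (∃ a : ℂ, u = a • v) ∧ c = 0) ∧
      ∀ y, ∃ u c, A u + B c = y := by
  have hQ := Submodule.finrank_quotient_add_finrank (Submodule.span ℂ {v})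
  rw [finrank_span_singleton hv, finrank_euclideanSpace_fin] at hQ
  have hdim : Module.finrank ℂ ((Cn n ⧸ Submodule.span ℂ {v}) × (Fin r → ℂ)) = Module.finrank ℂ (Cn m) := by
    rw [Module.finrank_prod, finrank_euclideanSpace_fin, Module.finrank_fin_fun]
    omega
  set e := LinearEquiv.ofFinrankEq _ (Cn m) hdim
  refine ⟨LinearMap.toContinuousLinearMap (e.toLinearMap ∘ₗ LinearMap.inl ℂ _ _ ∘ₗ
    (Submodule.span ℂ {v}).mkQ), LinearMap.toContinuousLinearMap
    (e.toLinearMap ∘ₗ LinearMap.inr ℂ _ _), fun u c => ?_, fun y => ?_⟩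
  · simp only [LinearMap.coe_toContinuousLinearMap', LinearMap.comp_apply, LinearMap.inl_apply,
      LinearMap.inr_apply, LinearEquiv.coe_coe]
    rw [← map_add, Prod.mk_add_mk, add_zero, zero_add, EmbeddingLike.map_eq_zero_iff,
      Submodule.mkQ_apply, Prod.mk_eq_zero, Submodule.Quotient.mk_eq_zero,
      Submodule.mem_span_singleton]
    simp only [eq_comm]
  · obtain ⟨u, hu⟩ := Submodule.mkQ_surjective _ (e.symm y).1
    refine ⟨u, (e.symm y).2, ?_⟩
    simp only [LinearMap.coe_toContinuousLinearMap', LinearMap.comp_apply, LinearMap.inl_apply,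
      LinearMap.inr_apply, LinearEquiv.coe_coe, hu]
    rw [← map_add]
    simp

end LinearAlgebra

section Cauchy

variable {E F : Type*} [NormedAddCommGroup E] [NormedSpace ℂ E]
  [NormedAddCommGroup F] [NormedSpace ℂ F]

/-- Cauchy's estimate for the derivative of a bounded holomorphic map. -/
theorem norm_fderiv_le_of_norm_le_on_ball {f : E → F} {c : E} {R C : ℝ} (hR : 0 < R)
    (hf : DifferentiableOn ℂ f (Metric.ball c R)) (hC : ∀ z ∈ Metric.ball c R, ‖f z‖ ≤ C) :
    ‖fderiv ℂ f c‖ ≤ 2 * C / R := by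
  refine Complex.norm_fderiv_le_div_of_mapsTo_ball hf (fun z hz => ?_) hR
  rw [Metric.mem_closedBall, dist_eq_norm]
  have h1 := norm_sub_le (f z) (f c)
  have h2 := hC z hz
  have h3 := hC c (Metric.mem_ball_self hR)
  linarith

theorem norm_fderiv_le_of_norm_le {f : E → F} {W : Set E} {c : E} {R C : ℝ} (hR : 0 < R)
    (hf : DifferentiableOn ℂ f W) (hW : Metric.ball c (2 * R) ⊆ W) (hC : ∀ z ∈ W, ‖f z‖ ≤ C) :
    ∀ z ∈ Metric.ball c R, ‖fderiv ℂ f z‖ ≤ 2 * C / R := by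
  intro z hz
  have hsub : Metric.ball z R ⊆ W :=
    (Metric.ball_subset_ball' (by rw [Metric.mem_ball] at hz; linarith)).trans hW
  exact norm_fderiv_le_of_norm_le_on_ball hR (hf.mono hsub) fun w hw => hC w (hsub hw)

theorem norm_sub_le_of_norm_le {f : E → F} {W : Set E} {c : E} {R C : ℝ} (hR : 0 < R)
    (hW' : IsOpen W)
    (hf : DifferentiableOn ℂ f W) (hW : Metric.ball c (2 * R) ⊆ W) (hC : ∀ z ∈ W, ‖f z‖ ≤ C) :
    ∀ z ∈ Metric.ball c R, ∀ w ∈ Metric.ball c R, ‖f z - f w‖ ≤ 2 * C / R * ‖z - w‖ := by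
  intro z hz w hw
  have : NormedSpace ℝ E := NormedSpace.restrictScalars ℝ ℂ E
  refine (convex_ball c R).norm_image_sub_le_of_norm_fderiv_le (𝕜 := ℂ) (fun x hx => ?_)
    (norm_fderiv_le_of_norm_le hR hf hW hC) hw hz
  exact hf.differentiableAt (hW'.mem_nhds (hW (Metric.ball_subset_ball (by linarith) hx)))

/-- The derivative of a bounded holomorphic map is Lipschitz, with a constant controlled by the
bound. -/
theorem norm_fderiv_sub_le_of_norm_le {f : E → F} {W : Set E} {c : E} {R C : ℝ} (hR : 0 < R)
    (hW' : IsOpen W) (hf : DifferentiableOn ℂ f W) (hW : Metric.ball c (4 * R) ⊆ W)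
    (hC : ∀ z ∈ W, ‖f z‖ ≤ C) :
    ∀ z ∈ Metric.ball c R, ∀ w ∈ Metric.ball c R,
      ‖fderiv ℂ f z - fderiv ℂ f w‖ ≤ 2 * C / R ^ 2 * ‖z - w‖ := by
  intro z hz w hw
  have hmem : ∀ x ∈ Metric.ball c R, ∀ t ∈ Metric.ball (0 : E) R,
      x + t ∈ Metric.ball c (2 * R) := fun x hx t ht => by
    rw [Metric.mem_ball, dist_eq_norm] at hx ⊢
    rw [mem_ball_zero_iff] at ht
    calc ‖x + t - c‖ = ‖(x - c) + t‖ := by congr 1; abel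
      _ ≤ ‖x - c‖ + ‖t‖ := norm_add_le _ _
      _ < 2 * R := by linarith
  have hdiff : ∀ x ∈ Metric.ball c R, ∀ t ∈ Metric.ball (0 : E) R,
      HasFDerivAt (fun t => f (x + t)) (fderiv ℂ f (x + t)) t := fun x hx t ht => by
    have h1 : x + t ∈ W := hW (Metric.ball_subset_ball (by linarith) (hmem x hx t ht))
    exact (hasFDerivAt_comp_add_left x).2 (hf.differentiableAt (hW'.mem_nhds h1)).hasFDerivAt
  have h0 : (0 : E) ∈ Metric.ball (0 : E) R := Metric.mem_ball_self hR
  have key := norm_fderiv_le_of_norm_le_on_ball (f := fun t => f (z + t) - f (w + t)) (c := 0)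
    (R := R) (C := C / R * ‖z - w‖) hR
    (fun t ht => ((hdiff z hz t ht).sub (hdiff w hw t ht)).differentiableAt.differentiableWithinAt)
    (fun t ht => by
      have := norm_sub_le_of_norm_le (R := 2 * R) (by linarith) hW' hf
        (by convert hW using 2; ring) hC _ (hmem z hz t ht) _ (hmem w hw t ht)
      rw [add_sub_add_right_eq_sub] at this
      convert this using 2
      field_simp)
  rw [((hdiff z hz 0 h0).fun_sub (hdiff w hw 0 h0)).fderiv, add_zero, add_zero] at key
  convert key using 1
  field_simp

/-- A holomorphic map on an open set is locally Lipschitz. -/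
theorem exists_lipschitzOnWith_of_differentiableOn {f : E → F} {W : Set E} {c : E}
    (hW : IsOpen W) (hf : DifferentiableOn ℂ f W) (hc : c ∈ W) :
    ∃ C : NNReal, ∃ t ∈ 𝓝 c, LipschitzOnWith C f t := by
  have hcont : ContinuousAt f c := (hf.differentiableAt (hW.mem_nhds hc)).continuousAt
  have hev : ∀ᶠ z in 𝓝 c, z ∈ W ∧ ‖f z‖ < ‖f c‖ + 1 :=
    Filter.Eventually.and (hW.mem_nhds hc) (hcont.norm.eventually_lt_const (by linarith))
  obtain ⟨R, hR, hball⟩ := Metric.mem_nhds_iff.1 hev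
  refine ⟨⟨2 * (‖f c‖ + 1) / (R / 2), by positivity⟩, Metric.ball c (R / 2),
    Metric.ball_mem_nhds _ (by linarith), LipschitzOnWith.of_dist_le_mul fun z hz w hw => ?_⟩
  rw [dist_eq_norm, dist_eq_norm]
  exact norm_sub_le_of_norm_le (W := Metric.ball c R) (by linarith) Metric.isOpen_ball
    (hf.mono fun x hx => (hball hx).1) (by rw [mul_div_cancel₀ _ two_ne_zero])
    (fun x hx => (hball hx).2.le) z hz w hw

end Cauchy

section Submanifold

variable {n : ℕ}

/-- The tangent space of a zero set is the kernel of the differential. -/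
theorem tangentSpace_eq_ker {Y : Type*} [NormedAddCommGroup Y] [NormedSpace ℝ Y]
    [FiniteDimensional ℝ Y] {ρ : Cn n → Y} {O M : Set (Cn n)} {p : Cn n}
    (hO : IsOpen O) (hp : p ∈ O) (hρ : AnalyticAt ℝ ρ p)
    (hsurj : Function.Surjective (fderiv ℝ ρ p)) (hpM : p ∈ M)
    (hM : M ∩ O = {z ∈ O | ρ z = 0}) :
    tangentSpace M p = (fderiv ℝ ρ p).toLinearMap.ker := by
  have : {v | ∃ γ : ℝ → Cn n, γ 0 = p ∧ (∀ᶠ t in 𝓝 (0 : ℝ), γ t ∈ M) ∧ HasDerivAt γ v 0}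
      = ((fderiv ℝ ρ p).toLinearMap.ker : Set (Cn n)) := by
    ext v
    exact exists_curve_iff_fderiv_eq_zero hO hp hρ hsurj hpM hM v
  rw [tangentSpace, this, Submodule.span_eq]

theorem IsRealAnalyticSubmanifold.finrank_tangentSpace {k : ℕ} {M : Set (Cn n)}
    (hM : IsRealAnalyticSubmanifold k M) {p : Cn n} (hp : p ∈ M) :
    Module.finrank ℝ (tangentSpace M p) + k = 2 * n := by
  obtain ⟨O, hO, hpO, ρ, hρ, hs, h⟩ := hM p hp
  rw [tangentSpace_eq_ker hO hpO (hρ p hpO) (hs p hpO) hp h]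
  have h1 := (fderiv ℝ ρ p).toLinearMap.finrank_range_add_finrank_ker
  rw [LinearMap.range_eq_top.2 (hs p hpO), finrank_top, Module.finrank_fin_fun,
    finrank_real_Cn] at h1
  omega

theorem IsRealAnalyticSubmanifold.exists_curve {k : ℕ} {M : Set (Cn n)}
    (hM : IsRealAnalyticSubmanifold k M) {p : Cn n} (hp : p ∈ M) {v : Cn n}
    (hv : v ∈ tangentSpace M p) :
    ∃ γ : ℝ → Cn n, γ 0 = p ∧ (∀ᶠ t in 𝓝 (0 : ℝ), γ t ∈ M) ∧ HasDerivAt γ v 0 := by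
  obtain ⟨O, hO, hpO, ρ, hρ, hs, h⟩ := hM p hp
  rw [tangentSpace_eq_ker hO hpO (hρ p hpO) (hs p hpO) hp h] at hv
  exact (exists_curve_iff_fderiv_eq_zero hO hpO (hρ p hpO) (hs p hpO) hp h v).2 hv

theorem IsRealAnalyticSubmanifold.dimH_le {k d : ℕ} {M : Set (Cn n)}
    (hM : IsRealAnalyticSubmanifold k M) (hd : d + k = 2 * n) : dimH M ≤ d := by
  refine dimH_le_of_locally fun p hp => ?_
  obtain ⟨O, hO, hpO, ρ, hρ, hs, h⟩ := hM p hp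
  obtain ⟨S, hS, hle⟩ := exists_nhdsWithin_dimH_le hO hpO (hρ p hpO) (hs p hpO) h
  refine ⟨S, hS, hle.trans ?_⟩
  have h1 := hM.finrank_tangentSpace hp
  rw [tangentSpace_eq_ker hO hpO (hρ p hpO) (hs p hpO) hp h] at h1
  exact_mod_cast (by omega)

theorem IsRealAnalyticSubmanifold.finrank_tangentSpace_le_dimH {k : ℕ} {M : Set (Cn n)}
    (hM : IsRealAnalyticSubmanifold k M) {p : Cn n} (hp : p ∈ M) :
    (Module.finrank ℝ (tangentSpace M p) : ℝ≥0∞) ≤ dimH M := by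
  obtain ⟨O, hO, hpO, ρ, hρ, hs, h⟩ := hM p hp
  rw [tangentSpace_eq_ker hO hpO (hρ p hpO) (hs p hpO) hp h]
  exact finrank_ker_le_dimH hO hpO (hρ p hpO) (hs p hpO) hp h

/-- If the image of an open part of a submanifold under a holomorphic map is a submanifold, its
tangent space at the image of an immersed point is the image of the tangent space. -/
theorem tangentSpace_image {m k k' : ℕ} {N W : Set (Cn n)} {G : Cn n → Cn m}
    (hN : IsRealAnalyticSubmanifold k N) (hW : IsOpen W) (hG : DifferentiableOn ℂ G W)
    (hM : IsRealAnalyticSubmanifold k' (G '' (N ∩ W))) {z : Cn n} (hz : z ∈ N ∩ W)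
    (hinj : ∀ u ∈ tangentSpace N z, fderiv ℂ G z u = 0 → u = 0) :
    tangentSpace (G '' (N ∩ W)) (G z) =
      (tangentSpace N z).map ((fderiv ℂ G z).toLinearMap.restrictScalars ℝ) := by
  have hzM : G z ∈ G '' (N ∩ W) := Set.mem_image_of_mem G hz
  have hGz := (hG.differentiableAt (hW.mem_nhds hz.2)).hasFDerivAt
  symm
  apply Submodule.eq_of_le_of_finrank_le
  · rintro _ ⟨v, hv, rfl⟩
    obtain ⟨γ, h0, hev, hd⟩ := hN.exists_curve hz.1 hv
    refine Submodule.subset_span ⟨fun t => G (γ t), by simp only [h0], ?_, ?_⟩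
    · have hWev : ∀ᶠ t in 𝓝 (0 : ℝ), γ t ∈ W :=
        hd.continuousAt.eventually (by rw [h0]; exact hW.mem_nhds hz.2)
      filter_upwards [hev, hWev] with t h1 h2
      exact Set.mem_image_of_mem G ⟨h1, h2⟩
    · have h1 : HasFDerivAt G ((fderiv ℂ G z).restrictScalars ℝ) (γ 0) := by
        rw [h0]; exact hGz.restrictScalars ℝ
      exact h1.comp_hasDerivAt 0 hd
  · have hfT : Module.finrank ℝ
        ((tangentSpace N z).map ((fderiv ℂ G z).toLinearMap.restrictScalars ℝ)) =
        Module.finrank ℝ (tangentSpace N z) := by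
      rw [← LinearMap.range_domRestrict]
      refine LinearMap.finrank_range_of_inj ?_
      rw [← LinearMap.ker_eq_bot, LinearMap.ker_eq_bot']
      exact fun u hu => Subtype.ext (hinj u u.2 hu)
    rw [hfT]
    have h1 := hM.finrank_tangentSpace_le_dimH hzM
    have h2 : dimH (G '' (N ∩ W)) ≤ dimH (N ∩ W) := by
      refine dimH_image_le_of_locally_lipschitzOn fun x hx => ?_
      obtain ⟨C, t, ht, hL⟩ := exists_lipschitzOnWith_of_differentiableOn hW hG hx.2
      exact ⟨C, t, mem_nhdsWithin_of_mem_nhds ht, hL⟩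
    have h3 : dimH (N ∩ W) ≤ dimH N := dimH_mono Set.inter_subset_left
    have h4 := hN.dimH_le (hN.finrank_tangentSpace hz.1)
    exact_mod_cast h1.trans (h2.trans (h3.trans h4))

theorem crDim_image_add_holRank {m k k' : ℕ} {N W : Set (Cn n)} {G : Cn n → Cn m}
    (hN : IsGenericSubmanifold k N) (hW : IsOpen W) (hG : DifferentiableOn ℂ G W)
    (hM : IsRealAnalyticSubmanifold k' (G '' (N ∩ W))) {z : Cn n} (hz : z ∈ N ∩ W)
    (hinj : ∀ u ∈ tangentSpace N z, fderiv ℂ G z u = 0 → u = 0) :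
    crDim (G '' (N ∩ W)) (G z) + holRank G z + k = 2 * n := by
  rw [holRank, crDim_add_finrank_range (fderiv ℂ G z) (hN.2 z hz.1)
    (tangentSpace_image hN.1 hW hG hM hz hinj) hinj]
  exact hN.1.finrank_tangentSpace hz.1

/-- If the image is a CR submanifold, the rank of the derivative is constant on connected sets
of immersed points. -/
theorem holRank_eq_of_isCRSubmanifold {m k : ℕ} {N W S : Set (Cn n)} {G : Cn n → Cn m}
    (hN : IsGenericSubmanifold k N) (hW : IsOpen W) (hG : DifferentiableOn ℂ G W)
    (hM : IsCRSubmanifold (G '' (N ∩ W))) (hS : IsPreconnected S) (hSN : S ⊆ N ∩ W)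
    (hinj : ∀ z ∈ S, ∀ u ∈ tangentSpace N z, fderiv ℂ G z u = 0 → u = 0)
    {z w : Cn n} (hz : z ∈ S) (hw : w ∈ S) : holRank G z = holRank G w := by
  obtain ⟨⟨k', hk'⟩, hCR⟩ := hM
  refine hS.constant (f := holRank G) ?_ hz hw
  intro x hx
  obtain ⟨-, d, hd⟩ := hCR (G x) (Set.mem_image_of_mem G (hSN hx))
  have hcont : Filter.Tendsto G (𝓝[S] x) (𝓝[G '' (N ∩ W)] (G x)) := by
    refine tendsto_nhdsWithin_iff.2 ⟨?_, ?_⟩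
    · exact (hG.differentiableAt (hW.mem_nhds (hSN hx).2)).continuousAt.tendsto.mono_left
        nhdsWithin_le_nhds
    · filter_upwards [self_mem_nhdsWithin] with y hy
      exact Set.mem_image_of_mem G (hSN hy)
  have hev : ∀ᶠ y in 𝓝[S] x, holRank G y = holRank G x := by
    filter_upwards [hcont.eventually hd, self_mem_nhdsWithin] with y hy hyS
    have h1 := crDim_image_add_holRank hN hW hG hk' (hSN hyS) (hinj y hyS)
    have h2 := crDim_image_add_holRank hN hW hG hk' (hSN hx) (hinj x hx)
    have h3 := (hcont.eventually hd).self_of_nhdsWithin hx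
    omega
  exact tendsto_nhds_of_eventually_eq hev

end Submanifold

section Auxiliary

theorem holRank_eq_iff {n m : ℕ} {F : Cn n → Cn m} {z : Cn n} :
    holRank F z = n ↔ ∀ u, fderiv ℂ F z u = 0 → u = 0 := by
  have h := (fderiv ℂ F z).toLinearMap.finrank_range_add_finrank_ker
  rw [finrank_euclideanSpace_fin] at h
  have h2 : (∀ u, fderiv ℂ F z u = 0 → u = 0) ↔
      Module.finrank ℂ (LinearMap.ker (fderiv ℂ F z).toLinearMap) = 0 := by
    rw [Submodule.finrank_eq_zero, LinearMap.ker_eq_bot']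
    rfl
  rw [h2, holRank]
  omega

/-- An injective linear map on a finite-dimensional space is bounded below. -/
theorem exists_pos_mul_norm_le {𝕜 E F : Type*} [NontriviallyNormedField 𝕜] [CompleteSpace 𝕜]
    [NormedAddCommGroup E] [NormedSpace 𝕜 E] [FiniteDimensional 𝕜 E] [NormedAddCommGroup F]
    [NormedSpace 𝕜 F] (L : E →L[𝕜] F) (hL : ∀ u, L u = 0 → u = 0) :
    ∃ c : ℝ, 0 < c ∧ ∀ u, c * ‖u‖ ≤ ‖L u‖ := by
  obtain ⟨K, hK, h⟩ := LinearMap.exists_antilipschitzWith L.toLinearMap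
    (LinearMap.ker_eq_bot'.2 hL)
  refine ⟨(K : ℝ)⁻¹, by positivity, fun u => ?_⟩
  have := h.le_mul_norm (map_zero L.toLinearMap) u
  rw [inv_mul_le_iff₀ (by exact_mod_cast hK)]
  exact this

/-- A zero at which the strict derivative is surjective persists, in every small ball, under
perturbations that are small in the Lipschitz sense. -/
theorem exists_zero_of_lipschitz_close {E F : Type*} [NormedAddCommGroup E] [NormedSpace ℝ E]
    [CompleteSpace E] [NormedAddCommGroup F] [NormedSpace ℝ F] [CompleteSpace F]
    {f : E → F} {f' : E →L[ℝ] F} {a : E} (hf : HasStrictFDerivAt f f' a)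
    (hsurj : Function.Surjective f') :
    ∃ r₀ : ℝ, 0 < r₀ ∧ ∀ r : ℝ, 0 < r → r ≤ r₀ → ∃ η : ℝ, 0 < η ∧ ∀ g : E → F,
      (∀ x ∈ Metric.closedBall a r, ∀ y ∈ Metric.closedBall a r,
        ‖(g x - f x) - (g y - f y)‖ ≤ η * ‖x - y‖) → ‖g a‖ ≤ η →
      ∃ x ∈ Metric.closedBall a r, g x = 0 := by
  set S := f'.nonlinearRightInverseOfSurjective (LinearMap.range_eq_top.2 hsurj) with hS
  have hSpos : 0 < S.nnnorm := f'.nonlinearRightInverseOfSurjective_nnnorm_pos _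
  set c : NNReal := S.nnnorm⁻¹ / 4 with hc
  have hcpos : 0 < c := by positivity
  obtain ⟨s, hs, happ⟩ := hf.approximates_deriv_on_nhds (c := c) (Or.inr hcpos)
  obtain ⟨r₀, hr₀, hball⟩ := Metric.nhds_basis_closedBall.mem_iff.1 hs
  refine ⟨r₀, hr₀, fun r hr hrr => ⟨min c (c * r), by positivity, fun g hg hga => ?_⟩⟩
  have hsub : Metric.closedBall a r ⊆ s := (Metric.closedBall_subset_closedBall hrr).trans hball
  have happ' : ApproximatesLinearOn g f' (Metric.closedBall a r) (2 * c) := by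
    intro x hx y hy
    have h1 := happ x (hsub hx) y (hsub hy)
    have h2 := hg x hx y hy
    have h3 : min (c : ℝ) (c * r) * ‖x - y‖ ≤ c * ‖x - y‖ := by
      gcongr
      exact min_le_left _ _
    calc ‖g x - g y - f' (x - y)‖
        = ‖(f x - f y - f' (x - y)) + ((g x - f x) - (g y - f y))‖ := by congr 1; abel
      _ ≤ c * ‖x - y‖ + c * ‖x - y‖ := (norm_add_le _ _).trans (add_le_add h1 (h2.trans h3))
      _ = (2 * c : NNReal) * ‖x - y‖ := by push_cast; ring
  have hsurjOn := happ'.surjOn_closedBall_of_nonlinearRightInverse S hr.le subset_rfl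
  obtain ⟨x, hx, hgx⟩ := hsurjOn (show (0 : F) ∈ _ by
    rw [Metric.mem_closedBall, dist_comm, dist_zero_right]
    refine hga.trans ((min_le_right _ _).trans ?_)
    have : (S.nnnorm : ℝ)⁻¹ = 4 * c := by rw [hc]; push_cast; ring
    rw [this]
    push_cast
    nlinarith [mul_pos (NNReal.coe_pos.2 hcpos) hr])
  exact ⟨x, hx, hgx⟩

theorem frequently_map_sub_ne_zero {n k : ℕ} {N : Set (Cn n)} {p t : Cn n} {F : Type*}
    [NormedAddCommGroup F] [NormedSpace ℝ F] (hN : IsRealAnalyticSubmanifold k N) (hp : p ∈ N)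
    (ht : t ∈ tangentSpace N p) (ℓ : Cn n →L[ℝ] F) (hℓ : ℓ t ≠ 0) :
    ∃ᶠ z in 𝓝[N] p, ℓ (z - p) ≠ 0 := by
  obtain ⟨γ, h0, hev, hd⟩ := hN.exists_curve hp ht
  have hγ : Filter.Tendsto γ (𝓝[≠] 0) (𝓝[N] p) := by
    refine tendsto_nhdsWithin_iff.2 ⟨?_, nhdsWithin_le_nhds hev⟩
    have := hd.continuousAt.tendsto
    rw [h0] at this
    exact this.mono_left nhdsWithin_le_nhds
  have hd' : HasDerivAt (fun s => ℓ (γ s - p)) (ℓ t) 0 :=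
    ℓ.hasFDerivAt.comp_hasDerivAt 0 (hd.sub_const p)
  exact hγ.frequently (hd'.eventually_ne (c := 0) hℓ).frequently

end Auxiliary

section Embedding

/-- A real-analytic map that is immersive on a submanifold at `p` restricts to a diffeomorphism onto
its image on every small open part of the submanifold. -/
theorem exists_isDiffeoOntoImage {n m k : ℕ} {N : Set (Cn n)} {f : Cn n → Cn m} {p : Cn n}
    (hN : IsRealAnalyticSubmanifold k N) (hp : p ∈ N) (hf : ∀ z, AnalyticAt ℝ f z)
    (hinj : ∀ u ∈ tangentSpace N p, fderiv ℝ f p u = 0 → u = 0) :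
    ∃ O : Set (Cn n), IsOpen O ∧ p ∈ O ∧ ∀ U' : Set (Cn n), IsOpen U' → U' ⊆ O →
      IsDiffeoOntoImage f (N ∩ U') := by
  obtain ⟨O, hO, hpO, ρ, hρ, hs, hNO⟩ := hN p hp
  have hmem : ∀ z ∈ O, (z ∈ N ↔ ρ z = 0) := fun z hz => by
    have := Set.ext_iff.1 hNO z
    simpa [hz] using this
  have hT := tangentSpace_eq_ker hO hpO (hρ p hpO) (hs p hpO) hp hNO
  obtain ⟨Λ, Φ, hpΦ, hΦO, hΦ, hsymm, -⟩ := exists_analytic_chart (f := f) (ρ := ρ)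
    (K := tangentSpace N p) (hO.mem_nhds hpO) (hf p) (hρ p hpO) (hs p hpO)
    (fun u => by rw [hT]; rfl) hinj
  refine ⟨Φ.source, Φ.open_source, hpΦ, fun U' hU' hU'Φ => ?_⟩
  set ι : Cn m →L[ℝ] tangentSpace N p × (Fin k → ℝ) := Λ.prod 0 with hι
  set OM : Set (Cn m) := ι ⁻¹' (Φ.target ∩ Φ.symm ⁻¹' U') with hOM
  have hOMopen : IsOpen OM := (Φ.isOpen_inter_preimage_symm hU').preimage ι.continuous
  set g : Cn m → Cn n := fun y => Φ.symm (ι y) with hg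
  have hgan : ∀ y ∈ OM, AnalyticAt ℝ g y := fun y hy =>
    (hsymm _ hy.1).comp (ι.analyticAt y)
  have hΦι : ∀ z ∈ N ∩ U', Φ z = ι (f z) := fun z hz => by
    rw [hΦ, (hmem z (hΦO (hU'Φ hz.2))).1 hz.1]; rfl
  have hfOM : ∀ z ∈ N ∩ U', f z ∈ OM ∧ g (f z) = z := fun z hz => by
    have h1 : g (f z) = z := by rw [hg]; simp only [← hΦι z hz]; exact Φ.left_inv (hU'Φ hz.2)
    refine ⟨⟨?_, ?_⟩, h1⟩
    · rw [← hΦι z hz]; exact Φ.map_source (hU'Φ hz.2)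
    · exact (congrArg (· ∈ U') h1).mpr hz.2
  have hgOM : ∀ y ∈ OM, g y ∈ N ∩ U' ∧ Λ (f (g y)) = Λ y := fun y hy => by
    have h1 := Φ.right_inv hy.1
    rw [hΦ] at h1
    exact ⟨⟨(hmem _ (hΦO (Φ.map_target hy.1))).2 (congrArg Prod.snd h1), hy.2⟩,
      congrArg Prod.fst h1⟩
  set Z : Submodule ℝ (Cn m) := Λ.toLinearMap.ker with hZ
  obtain ⟨π, hπ⟩ := LinearMap.exists_leftInverse_of_injective Z.subtype
    (LinearMap.ker_eq_bot.2 Z.subtype_injective)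
  set e : Z ≃ₗ[ℝ] (Fin (Module.finrank ℝ Z) → ℝ) :=
    LinearEquiv.ofFinrankEq _ _ (Module.finrank_fin_fun ℝ).symm with he
  set κ : Cn m →L[ℝ] (Fin (Module.finrank ℝ Z) → ℝ) :=
    LinearMap.toContinuousLinearMap (e.toLinearMap ∘ₗ π) with hκ
  have hκZ : ∀ u : Z, κ u = e u := fun u => congrArg e (LinearMap.congr_fun hπ u)
  refine ⟨⟨Module.finrank ℝ Z, ?_⟩, fun z _ => hf z, ?_, ?_⟩
  · rintro _ ⟨z, hz, rfl⟩
    have hran : ∀ y ∈ OM, AnalyticAt ℝ (fun y => κ (y - f (g y))) y := fun y hy =>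
      (κ.analyticAt _).comp (analyticAt_id.sub ((hf _).comp (hgan y hy)))
    refine ⟨OM, hOMopen, (hfOM z hz).1, fun y => κ (y - f (g y)), hran, fun y hy w => ?_, ?_⟩
    · refine ⟨((e.symm w : Z) : Cn m), ?_⟩
      set u : Cn m := ((e.symm w : Z) : Cn m) with hu
      have hιu : ι u = 0 := Prod.ext (e.symm w).2 rfl
      have hgd : HasFDerivAt g (fderiv ℝ Φ.symm (ι y) ∘L ι) y :=
        (hsymm _ hy.1).differentiableAt.hasFDerivAt.comp y ι.hasFDerivAt
      have hd : HasFDerivAt (fun y => κ (y - f (g y))) (κ ∘L (ContinuousLinearMap.id ℝ _ -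
          fderiv ℝ f (g y) ∘L (fderiv ℝ Φ.symm (ι y) ∘L ι))) y :=
        κ.hasFDerivAt.comp y ((hasFDerivAt_id y).sub
          ((hf (g y)).differentiableAt.hasFDerivAt.comp y hgd))
      rw [hd.fderiv]
      simp only [ContinuousLinearMap.comp_apply, sub_apply, hιu, map_zero,
        sub_zero, ContinuousLinearMap.id_apply]
      rw [hu, hκZ, e.apply_symm_apply]
    · ext y
      constructor
      · rintro ⟨⟨x, hx, rfl⟩, hy⟩
        exact ⟨hy, by simp only [(hfOM x hx).2, sub_self, map_zero]⟩
      · rintro ⟨hy, hκy⟩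
        refine ⟨⟨g y, (hgOM y hy).1, ?_⟩, hy⟩
        have hmemZ : y - f (g y) ∈ Z := by
          rw [hZ, LinearMap.mem_ker]
          exact (map_sub Λ _ _).trans (sub_eq_zero.2 (hgOM y hy).2.symm)
        have h1 : e ⟨y - f (g y), hmemZ⟩ = 0 := (hκZ ⟨_, hmemZ⟩).symm.trans hκy
        rw [EmbeddingLike.map_eq_zero_iff] at h1
        exact (sub_eq_zero.1 (congrArg Subtype.val h1)).symm
  · intro z hz w hw hzw
    rw [← (hfOM z hz).2, ← (hfOM w hw).2, hzw]
  · intro z hz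
    refine ⟨g, hgan _ (hfOM z hz).1, ?_⟩
    filter_upwards [self_mem_nhdsWithin] with y hy
    obtain ⟨x, hx, rfl⟩ := hy
    rw [(hfOM x hx).2]
    exact ⟨hx, rfl⟩

end Embedding

section Model

variable {n m r : ℕ} (A : Cn n →L[ℂ] Cn m) (B : (Fin r → ℂ) →L[ℂ] Cn m)
  (ℓ : Cn n →L[ℂ] (Fin r → ℂ)) (l : Cn n →L[ℂ] ℂ) (v p : Cn n) (q : Cn m)

/-- The quadratic perturbation of the affine map with linear part `A` whose derivative in the
direction `v` is `B ∘ ℓ`, provided that `A v = 0` and `l v = 1`. -/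
noncomputable def foldMap (z : Cn n) : Cn m :=
  q + A (z - p) + B (l (z - p) • ℓ (z - p) - ((1 / 2 : ℂ) * (l (z - p) * l (z - p))) • ℓ v)

/-- The derivative of `foldMap`. -/
noncomputable def foldDeriv (z : Cn n) : Cn n →L[ℂ] Cn m :=
  A + B ∘L (l.smulRight (ℓ (z - p)) + l (z - p) • ℓ - l (z - p) • l.smulRight (ℓ v))

theorem hasFDerivAt_foldMap (z : Cn n) :
    HasFDerivAt (foldMap A B ℓ l v p q) (foldDeriv A B ℓ l v p z) z := by
  have hs : HasFDerivAt (fun z : Cn n => z - p) (ContinuousLinearMap.id ℂ _) z :=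
    (hasFDerivAt_id z).sub_const p
  have hl : HasFDerivAt (fun z => l (z - p)) l z := l.hasFDerivAt.comp z hs
  have hℓ : HasFDerivAt (fun z => ℓ (z - p)) ℓ z := ℓ.hasFDerivAt.comp z hs
  have hA : HasFDerivAt (fun z => A (z - p)) A z := A.hasFDerivAt.comp z hs
  have h := (hA.const_add q).add (B.hasFDerivAt.comp z ((hl.smul hℓ).sub
    (((hl.mul hl).const_mul (1 / 2 : ℂ)).smul_const (ℓ v))))
  refine h.congr_fderiv ?_
  ext1 u
  simp only [foldDeriv, add_apply, ContinuousLinearMap.comp_apply,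
    sub_apply, smul_apply,
    ContinuousLinearMap.smulRight_apply, smul_eq_mul]
  congr 2
  rw [smul_smul, add_comm (l (z - p) • ℓ u)]
  congr 2
  ring

theorem fderiv_foldMap (z : Cn n) :
    fderiv ℂ (foldMap A B ℓ l v p q) z = foldDeriv A B ℓ l v p z :=
  (hasFDerivAt_foldMap A B ℓ l v p q z).fderiv

theorem differentiable_foldMap : Differentiable ℂ (foldMap A B ℓ l v p q) := fun z =>
  (hasFDerivAt_foldMap A B ℓ l v p q z).differentiableAt

theorem analyticAt_foldMap (z : Cn n) : AnalyticAt ℝ (foldMap A B ℓ l v p q) z := by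
  have hs : AnalyticAt ℂ (fun z : Cn n => z - p) z := analyticAt_id.sub analyticAt_const
  have hl : AnalyticAt ℂ (fun z => l (z - p)) z := (l.analyticAt _).comp hs
  have hℓ : AnalyticAt ℂ (fun z => ℓ (z - p)) z := (ℓ.analyticAt _).comp hs
  have hA : AnalyticAt ℂ (fun z => A (z - p)) z := (A.analyticAt _).comp hs
  have h : AnalyticAt ℂ (foldMap A B ℓ l v p q) z :=
    (analyticAt_const.add hA).add ((B.analyticAt _).comp ((hl.smul hℓ).sub
      ((analyticAt_const.mul (hl.mul hl)).smul analyticAt_const)))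
  exact h.restrictScalars

@[simp]
theorem foldMap_self : foldMap A B ℓ l v p q p = q := by simp [foldMap]

@[simp]
theorem foldDeriv_self : foldDeriv A B ℓ l v p p = A := by
  ext1 u; simp [foldDeriv]

theorem continuous_foldDeriv : Continuous (foldDeriv A B ℓ l v p) := by
  have : foldDeriv A B ℓ l v p = fun z =>
      A + B ∘L (ContinuousLinearMap.smulRightL ℂ (Cn n) (Fin r → ℂ) l (ℓ (z - p)) +
        l (z - p) • ℓ - l (z - p) • l.smulRight (ℓ v)) := rfl
  rw [this]
  fun_prop

variable {A B ℓ l v p q}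

theorem foldDeriv_apply_direction (hA : A v = 0) (hl : l v = 1) (z : Cn n) :
    foldDeriv A B ℓ l v p z v = B (ℓ (z - p)) := by
  simp [foldDeriv, hA, hl]

theorem foldDeriv_eq_zero_iff (hl : l v = 1)
    (hAB : ∀ u c, A u + B c = 0 ↔ (∃ a : ℂ, u = a • v) ∧ c = 0) (z : Cn n) :
    (∀ u, foldDeriv A B ℓ l v p z u = 0 → u = 0) ↔ ℓ (z - p) ≠ 0 := by
  have hA : A v = 0 := by
    have := (hAB v 0).2 ⟨⟨1, (one_smul _ _).symm⟩, rfl⟩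
    simpa using this
  constructor
  · intro h h0
    have := h v (by rw [foldDeriv_apply_direction hA hl, h0, map_zero])
    rw [this, map_zero] at hl
    exact zero_ne_one hl
  · intro h u hu
    obtain ⟨⟨a, rfl⟩, -⟩ := (hAB u _).1 hu
    rw [map_smul, foldDeriv_apply_direction hA hl] at hu
    rcases smul_eq_zero.1 hu with ha | hB
    · rw [ha, zero_smul]
    · exact absurd ((hAB 0 (ℓ (z - p))).1 (by rw [map_zero, zero_add, hB])).2 h

theorem holRank_foldMap (hl : l v = 1)
    (hAB : ∀ u c, A u + B c = 0 ↔ (∃ a : ℂ, u = a • v) ∧ c = 0) (z : Cn n) :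
    holRank (foldMap A B ℓ l v p q) z = n ↔ ℓ (z - p) ≠ 0 := by
  rw [holRank_eq_iff, fderiv_foldMap, foldDeriv_eq_zero_iff hl hAB]

theorem genericallyFullRank_foldMap (hl : l v = 1)
    (hAB : ∀ u c, A u + B c = 0 ↔ (∃ a : ℂ, u = a • v) ∧ c = 0) (hℓ : ∃ w, ℓ w ≠ 0)
    {U : Set (Cn n)} (hU : IsOpen U) :
    GenericallyFullRank (foldMap A B ℓ l v p q) U := by
  have hopen : IsOpen {z : Cn n | ℓ (z - p) ≠ 0} :=
    isOpen_ne_fun (by fun_prop) continuous_const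
  refine ⟨U ∩ {z | ℓ (z - p) ≠ 0}, hU.inter hopen, Set.inter_subset_left, fun z hz => ?_,
    fun z hz => (holRank_foldMap hl hAB z).2 hz.2⟩
  by_cases h : ℓ (z - p) = 0
  · obtain ⟨w, hw⟩ := hℓ
    have hc : ContinuousAt (fun t : ℂ => z + t • w) 0 := by fun_prop
    have ht : Filter.Tendsto (fun t : ℂ => z + t • w) (𝓝[≠] 0) (𝓝 z) := by
      have := hc.tendsto
      rw [zero_smul, add_zero] at this
      exact this.mono_left nhdsWithin_le_nhds
    refine mem_closure_of_tendsto ht ?_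
    filter_upwards [ht (hU.mem_nhds hz), self_mem_nhdsWithin] with t htU ht0
    refine ⟨htU, ?_⟩
    have : z + t • w - p = (z - p) + t • w := by abel
    change ℓ (z + t • w - p) ≠ 0
    rw [this, map_add, h, zero_add, map_smul]
    exact smul_ne_zero ht0 hw
  · exact subset_closure ⟨hz, h⟩

/-- The incidence map of the degeneracy of `foldMap` is a submersion at `(p, 0)`. -/
theorem hasStrictFDerivAt_foldDeriv_apply (hl : l v = 1) :
    HasStrictFDerivAt (fun x : Cn n × Cn n => foldDeriv A B ℓ l v p x.1 (v + x.2))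
      (A ∘L ContinuousLinearMap.snd ℂ _ _ + (B ∘L ℓ) ∘L ContinuousLinearMap.fst ℂ _ _)
      (p, 0) := by
  have hfst : HasStrictFDerivAt (fun x : Cn n × Cn n => x.1 - p)
      (ContinuousLinearMap.fst ℂ _ _) (p, 0) := hasStrictFDerivAt_fst.sub_const p
  have hsnd : HasStrictFDerivAt (fun x : Cn n × Cn n => v + x.2)
      (ContinuousLinearMap.snd ℂ _ _) (p, 0) := hasStrictFDerivAt_snd.const_add v
  have h1 := l.hasStrictFDerivAt.comp (p, (0 : Cn n)) hfst
  have h2 := ℓ.hasStrictFDerivAt.comp (p, (0 : Cn n)) hfst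
  have h3 := l.hasStrictFDerivAt.comp (p, (0 : Cn n)) hsnd
  have h4 := ℓ.hasStrictFDerivAt.comp (p, (0 : Cn n)) hsnd
  have h5 := A.hasStrictFDerivAt.comp (p, (0 : Cn n)) hsnd
  have h := h5.add (B.hasStrictFDerivAt.comp (p, (0 : Cn n)) (((h3.smul h2).add (h1.smul h4)).sub
    (h1.smul (h3.smul_const (ℓ v)))))
  refine h.congr_fderiv ?_
  refine ContinuousLinearMap.ext fun x => ?_
  simp [hl]

end Model

section Stability

variable {n m k r : ℕ} {A : Cn n →L[ℂ] Cn m} {B : (Fin r → ℂ) →L[ℂ] Cn m}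
  {ℓ : Cn n →L[ℂ] (Fin r → ℂ)} {l : Cn n →L[ℂ] ℂ} {v p : Cn n} {q : Cn m}

/-- Holomorphic maps close to `foldMap` have a degenerate derivative at some point near `p` of the
submanifold. -/
theorem exists_degenerate_point {ρ : Cn n → Fin k → ℝ} (hρ : AnalyticAt ℝ ρ p) (hρp : ρ p = 0)
    (hl : l v = 1) (hAB : ∀ u c, A u + B c = 0 ↔ (∃ a : ℂ, u = a • v) ∧ c = 0)
    (hAB' : ∀ y, ∃ u c, A u + B c = y)
    (hsurj : Function.Surjective (fderiv ℝ ρ p))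
    (hℓ : ∀ c, ∃ t, fderiv ℝ ρ p t = 0 ∧ ℓ t = c) :
    ∃ r₀ : ℝ, 0 < r₀ ∧ ∀ s : ℝ, 0 < s → s ≤ r₀ → ∀ (W : Set (Cn n)) (R : ℝ), IsOpen W → s < R →
      Metric.ball p (4 * R) ⊆ W → ∃ ε : ℝ, 0 < ε ∧ ∀ G : Cn n → Cn m, DifferentiableOn ℂ G W →
        (∀ z ∈ W, ‖foldMap A B ℓ l v p q z - G z‖ ≤ ε) →
        ∃ z ∈ Metric.closedBall p s, ρ z = 0 ∧ ∃ u, u ≠ 0 ∧ fderiv ℂ G z u = 0 := by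
  have hA : A v = 0 := by
    have := (hAB v 0).2 ⟨⟨1, (one_smul _ _).symm⟩, rfl⟩
    simpa using this
  have hv : v ≠ 0 := by rintro rfl; simp at hl
  set f : Cn n × Cn n → (Fin k → ℝ) × Cn m :=
    fun x => (ρ x.1, foldDeriv A B ℓ l v p x.1 (v + x.2)) with hf
  set f' : Cn n × Cn n →L[ℝ] (Fin k → ℝ) × Cn m :=
    (fderiv ℝ ρ p ∘L ContinuousLinearMap.fst ℝ _ _).prod
      ((A ∘L ContinuousLinearMap.snd ℂ _ _ + (B ∘L ℓ) ∘L
        ContinuousLinearMap.fst ℂ (Cn n) (Cn n)).restrictScalars ℝ) with hf'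
  have hstrict : HasStrictFDerivAt f f' (p, 0) := by
    refine HasStrictFDerivAt.prodMk ?_
      ((hasStrictFDerivAt_foldDeriv_apply hl).restrictScalars ℝ)
    exact hρ.hasStrictFDerivAt.comp (p, (0 : Cn n)) hasStrictFDerivAt_fst
  have hf'surj : Function.Surjective f' := by
    rintro ⟨a, b⟩
    obtain ⟨u, c, rfl⟩ := hAB' b
    obtain ⟨ζ, rfl⟩ := hsurj a
    obtain ⟨t, ht, htc⟩ := hℓ (c - ℓ ζ)
    refine ⟨(ζ + t, u), Prod.ext ?_ ?_⟩
    · change fderiv ℝ ρ p (ζ + t) = _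
      rw [map_add, ht, add_zero]
    · change A u + B (ℓ (ζ + t)) = A u + B c
      rw [map_add, htc, add_sub_cancel]
  obtain ⟨r₀, hr₀, hzero⟩ := exists_zero_of_lipschitz_close hstrict hf'surj
  refine ⟨min r₀ (min 1 (‖v‖ / 2)), by positivity, fun s hs hsr W R hW hsR hWR => ?_⟩
  have hsr₀ : s ≤ r₀ := hsr.trans (min_le_left _ _)
  have hs1 : s ≤ 1 := hsr.trans ((min_le_right _ _).trans (min_le_left _ _))
  have hsv : s ≤ ‖v‖ / 2 := hsr.trans ((min_le_right _ _).trans (min_le_right _ _))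
  have hvpos : 0 < ‖v‖ := norm_pos_iff.2 hv
  obtain ⟨η, hη, hG⟩ := hzero s hs hsr₀
  have hR : 0 < R := hs.trans hsR
  set C : ℝ := 2 / R ^ 2 * (‖v‖ + 1) + 2 / R * (‖v‖ + 1) with hC
  have hCpos : 0 < C := by positivity
  refine ⟨η / C, by positivity, fun G hGd hGε => ?_⟩
  set ε := η / C with hε
  have hεpos : 0 < ε := by positivity
  have hεC : ε * C = η := div_mul_cancel₀ _ hCpos.ne'
  set E : Cn n → Cn m := fun z => foldMap A B ℓ l v p q z - G z with hE
  have hEd : DifferentiableOn ℂ E W :=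
    (differentiable_foldMap A B ℓ l v p q).differentiableOn.sub hGd
  have hEder : ∀ z ∈ W, fderiv ℂ E z = foldDeriv A B ℓ l v p z - fderiv ℂ G z := fun z hz =>
    ((hasFDerivAt_foldMap A B ℓ l v p q z).sub
      (hGd.differentiableAt (hW.mem_nhds hz)).hasFDerivAt).fderiv
  have hb1 := norm_fderiv_le_of_norm_le hR hEd
    ((Metric.ball_subset_ball (by linarith)).trans hWR) hGε
  have hb2 := norm_fderiv_sub_le_of_norm_le hR hW hEd hWR hGε
  have hballW : Metric.ball p R ⊆ W := (Metric.ball_subset_ball (by linarith)).trans hWR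
  have hmem : ∀ x ∈ Metric.closedBall ((p, 0) : Cn n × Cn n) s,
      x.1 ∈ Metric.closedBall p s ∧ x.1 ∈ Metric.ball p R ∧ ‖x.2‖ ≤ s := by
    intro x hx
    rw [Metric.mem_closedBall, Prod.dist_eq, max_le_iff, dist_zero_right] at hx
    exact ⟨hx.1, lt_of_le_of_lt hx.1 hsR, hx.2⟩
  obtain ⟨x, hx, hgx⟩ := hG (fun x => (ρ x.1, fderiv ℂ G x.1 (v + x.2))) (by
    intro x hx y hy
    obtain ⟨-, hx1, hx2⟩ := hmem x hx
    obtain ⟨-, hy1, hy2⟩ := hmem y hy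
    have h1 : ((ρ x.1, fderiv ℂ G x.1 (v + x.2)) - f x) - ((ρ y.1, fderiv ℂ G y.1 (v + y.2)) - f y)
        = (0, -((fderiv ℂ E x.1 - fderiv ℂ E y.1) (v + x.2) + fderiv ℂ E y.1 (x.2 - y.2))) := by
      rw [hEder _ (hballW hx1), hEder _ (hballW hy1), hf]
      refine Prod.ext ?_ ?_
      · simp
      · simp only [Prod.snd_sub, sub_apply, map_add, map_sub]
        abel
    have hfst : ‖x.1 - y.1‖ ≤ ‖x - y‖ := norm_fst_le (x - y)
    have hsnd : ‖x.2 - y.2‖ ≤ ‖x - y‖ := norm_snd_le (x - y)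
    have hvx : ‖v + x.2‖ ≤ ‖v‖ + 1 := (norm_add_le _ _).trans (by linarith)
    rw [h1, Prod.norm_mk, norm_zero, norm_neg, max_eq_right (norm_nonneg _)]
    calc _ ≤ ‖fderiv ℂ E x.1 - fderiv ℂ E y.1‖ * ‖v + x.2‖ + ‖fderiv ℂ E y.1‖ * ‖x.2 - y.2‖ :=
          (norm_add_le _ _).trans (add_le_add (ContinuousLinearMap.le_opNorm _ _)
            (ContinuousLinearMap.le_opNorm _ _))
      _ ≤ (2 * ε / R ^ 2 * ‖x - y‖) * (‖v‖ + 1) + (2 * ε / R) * ‖x - y‖ := by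
          gcongr
          · exact (hb2 _ hx1 _ hy1).trans (by gcongr)
          · exact hb1 _ hy1
      _ ≤ (2 * ε / R ^ 2 * ‖x - y‖) * (‖v‖ + 1) + (2 * ε / R) * (‖v‖ + 1) * ‖x - y‖ := by
          gcongr
          exact le_mul_of_one_le_right (by positivity) (by linarith)
      _ = ε * C * ‖x - y‖ := by rw [hC]; ring
      _ = η * ‖x - y‖ := by rw [hεC]) (by
    have hpR : p ∈ Metric.ball p R := Metric.mem_ball_self hR
    have h1 : fderiv ℂ G p v = -(fderiv ℂ E p v) := by
      rw [hEder p (hballW hpR), foldDeriv_self, sub_apply, hA]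
      abel
    simp only [hρp, add_zero, h1]
    rw [Prod.norm_mk, norm_zero, norm_neg, max_eq_right (norm_nonneg _)]
    calc _ ≤ ‖fderiv ℂ E p‖ * ‖v‖ := ContinuousLinearMap.le_opNorm _ _
      _ ≤ (2 * ε / R) * (‖v‖ + 1) := by
          gcongr
          · exact hb1 p hpR
          · linarith
      _ ≤ ε * C := by
          have : 0 ≤ ε * (2 / R ^ 2 * (‖v‖ + 1)) := by positivity
          rw [hC]
          calc _ = ε * (2 / R * (‖v‖ + 1)) := by ring
            _ ≤ _ := by linarith
      _ = η := hεC)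
  obtain ⟨hx1, -, hx2⟩ := hmem x hx
  refine ⟨x.1, hx1, congrArg Prod.fst hgx, v + x.2, fun h0 => ?_, congrArg Prod.snd hgx⟩
  have : ‖v‖ = ‖x.2‖ := by rw [eq_neg_of_add_eq_zero_left h0, norm_neg]
  linarith

end Stability

theorem norm_sub_le_of_supDist_lt {n m : ℕ} {W : Set (Cn n)} {F G : Cn n → Cn m} {ε : ℝ}
    (hε : 0 < ε) (h : supDist W F G < ENNReal.ofReal ε) : ∀ z ∈ W, ‖F z - G z‖ ≤ ε := by
  intro z hz
  have h1 : ‖F z - G z‖ₑ ≤ supDist W F G := le_iSup₂_of_le z hz le_rfl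
  have h2 := h1.trans h.le
  rw [← ofReal_norm, ENNReal.ofReal_le_ofReal_iff hε.le] at h2
  exact h2

theorem supDist_lt_of_bound {n m : ℕ} {W : Set (Cn n)} {F G : Cn n → Cn m} {ε : ℝ}
    (hε : 0 < ε) (h : ∀ z ∈ W, ‖F z - G z‖ ≤ ε / 2) : supDist W F G < ENNReal.ofReal ε := by
  refine lt_of_le_of_lt (iSup₂_le fun z hz => ?_)
    ((ENNReal.ofReal_lt_ofReal_iff hε).2 (half_lt_self hε))
  rw [← ofReal_norm]
  exact ENNReal.ofReal_le_ofReal (h z hz)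

theorem GenericallyFullRank.le {n m : ℕ} {F : Cn n → Cn m} {U : Set (Cn n)}
    (h : GenericallyFullRank F U) (hU : U.Nonempty) : n ≤ m := by
  obtain ⟨O, -, -, hcl, hrk⟩ := h
  obtain ⟨z, hz⟩ := closure_nonempty_iff.1 (hU.mono hcl)
  rw [← hrk z hz, holRank]
  exact (Submodule.finrank_le _).trans_eq finrank_euclideanSpace_fin

section Robust

variable {n m k r : ℕ} {N : Set (Cn n)} {A : Cn n →L[ℂ] Cn m} {B : (Fin r → ℂ) →L[ℂ] Cn m}
  {ℓ : Cn n →L[ℂ] (Fin r → ℂ)} {l : Cn n →L[ℂ] ℂ} {v p : Cn n} {q : Cn m}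

/-- Holomorphic maps whose derivative is close to that of `foldMap` are immersive on the submanifold
near `p`. -/
theorem exists_immersive_of_close (hN : IsRealAnalyticSubmanifold k N) (hp : p ∈ N)
    (hAT : ∀ u ∈ tangentSpace N p, A u = 0 → u = 0) :
    ∃ c : ℝ, 0 < c ∧ ∃ V ∈ 𝓝 p, ∀ z ∈ N ∩ V, ∀ L : Cn n →L[ℂ] Cn m,
      ‖foldDeriv A B ℓ l v p z - L‖ ≤ c → ∀ u ∈ tangentSpace N z, L u = 0 → u = 0 := by
  obtain ⟨O, hO, hpO, ρ, hρ, hs, hNO⟩ := hN p hp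
  have hT : ∀ z ∈ N ∩ O, tangentSpace N z = (fderiv ℝ ρ z).toLinearMap.ker := fun z hz =>
    tangentSpace_eq_ker hO hz.2 (hρ z hz.2) (hs z hz.2) hz.1 hNO
  obtain ⟨c, hc, hbound⟩ := exists_pos_mul_norm_le ((A.restrictScalars ℝ).prod (fderiv ℝ ρ p))
    (fun u hu => hAT u (by rw [hT p ⟨hp, hpO⟩]; exact congrArg Prod.snd hu)
      (congrArg Prod.fst hu))
  have h1 : ∀ᶠ z in 𝓝 p, ‖foldDeriv A B ℓ l v p z - A‖ < c / 4 := by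
    have : ContinuousAt (fun z => ‖foldDeriv A B ℓ l v p z - A‖) p :=
      ((continuous_foldDeriv A B ℓ l v p).sub continuous_const).norm.continuousAt
    refine this.eventually_lt_const ?_
    beta_reduce
    rw [foldDeriv_self, sub_self, norm_zero]
    positivity
  have h2 : ∀ᶠ z in 𝓝 p, ‖fderiv ℝ ρ z - fderiv ℝ ρ p‖ < c / 4 := by
    have : ContinuousAt (fun z => ‖fderiv ℝ ρ z - fderiv ℝ ρ p‖) p :=
      ((hρ p hpO).fderiv.continuousAt.sub continuousAt_const).norm
    refine this.eventually_lt_const ?_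
    beta_reduce
    rw [sub_self, norm_zero]
    positivity
  refine ⟨c / 4, by positivity, _, (h1.and h2).and (hO.mem_nhds hpO), ?_⟩
  rintro z ⟨hzN, ⟨hz1, hz2⟩, hzO⟩ L hL u hu hLu
  rw [hT z ⟨hzN, hzO⟩] at hu
  have hu' : fderiv ℝ ρ z u = 0 := hu
  have h3 := hbound u
  have h4 : ‖A u‖ ≤ c / 2 * ‖u‖ := by
    have h5 : A u = -((foldDeriv A B ℓ l v p z - A) u) + (foldDeriv A B ℓ l v p z - L) u := by
      rw [sub_apply, sub_apply, hLu]; abel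
    calc ‖A u‖ ≤ ‖foldDeriv A B ℓ l v p z - A‖ * ‖u‖ + ‖foldDeriv A B ℓ l v p z - L‖ * ‖u‖ := by
          rw [h5]
          refine (norm_add_le _ _).trans ?_
          rw [norm_neg]
          exact add_le_add (ContinuousLinearMap.le_opNorm _ _)
            (ContinuousLinearMap.le_opNorm _ _)
      _ ≤ c / 4 * ‖u‖ + c / 4 * ‖u‖ := by gcongr
      _ = c / 2 * ‖u‖ := by ring
  have h6 : ‖fderiv ℝ ρ p u‖ ≤ c / 2 * ‖u‖ := by
    have h5 : fderiv ℝ ρ p u = -((fderiv ℝ ρ z - fderiv ℝ ρ p) u) := by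
      rw [sub_apply, hu']; abel
    rw [h5, norm_neg]
    refine (ContinuousLinearMap.le_opNorm _ _).trans ?_
    gcongr
    linarith
  have h7 : ‖((A.restrictScalars ℝ).prod (fderiv ℝ ρ p)) u‖ ≤ c / 2 * ‖u‖ := max_le h4 h6
  have h8 := norm_nonneg u
  have h9 : ‖u‖ = 0 := by nlinarith
  exact norm_eq_zero.1 h9

/-- The image of the submanifold under `foldMap` is not a CR submanifold near `p`, and this persists
for all nearby holomorphic maps. -/
theorem exists_pos_forall_close_not_isCRSubmanifold (hN : IsGenericSubmanifold k N) (hp : p ∈ N)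
    (hAT : ∀ u ∈ tangentSpace N p, A u = 0 → u = 0) (hl : l v = 1)
    (hAB : ∀ u c, A u + B c = 0 ↔ (∃ a : ℂ, u = a • v) ∧ c = 0)
    (hAB' : ∀ y, ∃ u c, A u + B c = y) (hℓ : ∀ c, ∃ t ∈ tangentSpace N p, ℓ t = c) (hr : 0 < r)
    {W : Set (Cn n)} (hW : IsOpen W) (hpW : p ∈ W) :
    ∃ ε : ℝ, 0 < ε ∧ ∀ G : Cn n → Cn m, DifferentiableOn ℂ G W →
      (∀ z ∈ W, ‖foldMap A B ℓ l v p q z - G z‖ ≤ ε) →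
      (∃ z ∈ N ∩ W, holRank G z ≠ n) ∧ ¬ IsCRSubmanifold (G '' (N ∩ W)) := by
  obtain ⟨O, hO, hpO, ρ, hρ, hs, hNO⟩ := hN.1 p hp
  have hmem : ∀ z ∈ O, (z ∈ N ↔ ρ z = 0) := fun z hz => by
    have := Set.ext_iff.1 hNO z
    simpa [hz] using this
  have hT := tangentSpace_eq_ker hO hpO (hρ p hpO) (hs p hpO) hp hNO
  obtain ⟨c₀, hc₀, V, hV, himm⟩ := exists_immersive_of_close (B := B) (ℓ := ℓ) (l := l) (v := v)
    hN.1 hp hAT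
  obtain ⟨r₀, hr₀, hdeg⟩ := exists_degenerate_point (q := q) (hρ p hpO) ((hmem p hpO).1 hp) hl hAB
    hAB' (hs p hpO) (fun c => by
      obtain ⟨t, ht, htc⟩ := hℓ c
      rw [hT] at ht
      exact ⟨t, ht, htc⟩)
  obtain ⟨R', hR', hball⟩ := Metric.mem_nhds_iff.1
    (Filter.inter_mem (hW.mem_nhds hpW) (Filter.inter_mem (hO.mem_nhds hpO) hV))
  set R := R' / 4 with hR
  have hRpos : 0 < R := by positivity
  have hRW : Metric.ball p (4 * R) ⊆ W ∩ (O ∩ V) := by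
    rwa [show 4 * R = R' by rw [hR]; ring]
  have hRR : Metric.ball p R ⊆ Metric.ball p (4 * R) := Metric.ball_subset_ball (by linarith)
  obtain ⟨S, hSsub, hSconn, hSnhds⟩ := exists_isPreconnected_nhdsWithin hO hpO (hρ p hpO)
    (hs p hpO) hp hNO (Metric.ball_mem_nhds p hRpos)
  obtain ⟨s₁, hs₁, hs₁S⟩ := Metric.mem_nhdsWithin_iff.1 hSnhds
  set s := min r₀ (min (R / 2) (s₁ / 2)) with hsdef
  have hspos : 0 < s := by positivity
  have hsR : s < R := by
    have : s ≤ R / 2 := (min_le_right _ _).trans (min_le_left _ _)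
    linarith
  have hss₁ : s < s₁ := by
    have : s ≤ s₁ / 2 := (min_le_right _ _).trans (min_le_right _ _)
    linarith
  obtain ⟨t, ht, htℓ⟩ := hℓ (fun _ => 1)
  have htne : (ℓ.restrictScalars ℝ) t ≠ 0 := by
    intro h0
    have h1 := congrFun (htℓ.symm.trans h0) ⟨0, hr⟩
    simp at h1
  obtain ⟨z₁, hz₁ℓ, hz₁S⟩ :=
    ((frequently_map_sub_ne_zero hN.1 hp ht _ htne).and_eventually hSnhds).exists
  obtain ⟨c₁, hc₁, hbound⟩ := exists_pos_mul_norm_le (foldDeriv A B ℓ l v p z₁)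
    ((foldDeriv_eq_zero_iff hl hAB z₁).2 hz₁ℓ)
  obtain ⟨ε₁, hε₁, hdegG⟩ := hdeg s hspos (min_le_left _ _) W R hW hsR
    (hRW.trans Set.inter_subset_left)
  refine ⟨min ε₁ (min (c₀ * R / 2) (c₁ * R / 4)), by positivity, fun G hG hGε => ?_⟩
  set ε := min ε₁ (min (c₀ * R / 2) (c₁ * R / 4)) with hε
  obtain ⟨z₀, hz₀s, hρz₀, u₀, hu₀, hGu₀⟩ := hdegG G hG fun z hz =>
    (hGε z hz).trans (min_le_left _ _)
  have hz₀ : z₀ ∈ N ∩ W ∧ z₀ ∈ S := by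
    have h1 : z₀ ∈ Metric.ball p R := Metric.closedBall_subset_ball hsR hz₀s
    have h2 := hRW (hRR h1)
    have h3 := (hmem z₀ h2.2.1).2 hρz₀
    exact ⟨⟨h3, h2.1⟩, hs₁S ⟨Metric.closedBall_subset_ball hss₁ hz₀s, h3⟩⟩
  have hrank₀ : holRank G z₀ ≠ n := fun h => hu₀ (holRank_eq_iff.1 h u₀ hGu₀)
  refine ⟨⟨z₀, hz₀.1, hrank₀⟩, fun hCR => hrank₀ ?_⟩
  have hclose : ∀ z ∈ Metric.ball p R, ‖foldDeriv A B ℓ l v p z - fderiv ℂ G z‖ ≤ 2 * ε / R := by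
    intro z hz
    have h1 := norm_fderiv_le_of_norm_le hRpos
      ((differentiable_foldMap A B ℓ l v p q).differentiableOn.fun_sub hG)
      ((Metric.ball_subset_ball (by linarith)).trans (hRW.trans Set.inter_subset_left)) hGε z hz
    rwa [((hasFDerivAt_foldMap A B ℓ l v p q z).fun_sub
      (hG.differentiableAt (hW.mem_nhds (hRW (hRR hz)).1)).hasFDerivAt).fderiv] at h1
  have hε0 : 2 * ε / R ≤ c₀ := by
    have : ε ≤ c₀ * R / 2 := (min_le_right _ _).trans (min_le_left _ _)
    rw [div_le_iff₀ hRpos]; linarith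
  have hε1 : 2 * ε / R ≤ c₁ / 2 := by
    have : ε ≤ c₁ * R / 4 := (min_le_right _ _).trans (min_le_right _ _)
    rw [div_le_iff₀ hRpos]; linarith
  have hrank₁ : holRank G z₁ = n := by
    refine holRank_eq_iff.2 fun u hu => ?_
    have h1 := hbound u
    have h2 : foldDeriv A B ℓ l v p z₁ u = (foldDeriv A B ℓ l v p z₁ - fderiv ℂ G z₁) u := by
      rw [sub_apply, hu, sub_zero]
    have h3 : ‖foldDeriv A B ℓ l v p z₁ u‖ ≤ c₁ / 2 * ‖u‖ := by
      rw [h2]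
      refine (ContinuousLinearMap.le_opNorm _ _).trans ?_
      gcongr
      exact (hclose z₁ (hSsub hz₁S).2).trans hε1
    have h4 := norm_nonneg u
    have h5 : ‖u‖ = 0 := by nlinarith
    exact norm_eq_zero.1 h5
  refine Eq.trans ?_ hrank₁
  refine holRank_eq_of_isCRSubmanifold hN hW hG hCR hSconn
    (fun z hz => ⟨(hSsub hz).1, (hRW (hRR (hSsub hz).2)).1⟩) (fun z hz => ?_) hz₀.2 hz₁S
  exact himm z ⟨(hSsub hz).1, (hRW (hRR (hSsub hz).2)).2.2⟩ _
    ((hclose z (hSsub hz).2).trans hε0)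

/-- The image of the submanifold under `foldMap` is CR singular at the image of `p`. -/
theorem not_isCRPoint_foldMap (hN : IsGenericSubmanifold k N) (hp : p ∈ N)
    (hAT : ∀ u ∈ tangentSpace N p, A u = 0 → u = 0) (hl : l v = 1)
    (hAB : ∀ u c, A u + B c = 0 ↔ (∃ a : ℂ, u = a • v) ∧ c = 0)
    (hℓ : ∃ t ∈ tangentSpace N p, ℓ t ≠ 0)
    {W : Set (Cn n)} (hW : IsOpen W) (hpW : p ∈ W) {k' : ℕ}
    (hM : IsRealAnalyticSubmanifold k' (foldMap A B ℓ l v p q '' (N ∩ W))) :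
    ¬ IsCRPoint (foldMap A B ℓ l v p q '' (N ∩ W)) (foldMap A B ℓ l v p q p) := by
  rintro ⟨-, d, hd⟩
  obtain ⟨c₀, hc₀, V, hV, himm⟩ := exists_immersive_of_close (B := B) (ℓ := ℓ) (l := l) (v := v)
    hN.1 hp hAT
  set F := foldMap A B ℓ l v p q with hF
  have hFd : DifferentiableOn ℂ F W := (differentiable_foldMap A B ℓ l v p q).differentiableOn
  have hNW : N ∩ W ∈ 𝓝[N] p := Filter.inter_mem self_mem_nhdsWithin
    (mem_nhdsWithin_of_mem_nhds (hW.mem_nhds hpW))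
  have hcont : Filter.Tendsto F (𝓝[N] p) (𝓝[F '' (N ∩ W)] (F p)) := by
    refine tendsto_nhdsWithin_iff.2
      ⟨((differentiable_foldMap A B ℓ l v p q) p).continuousAt.tendsto.mono_left
        nhdsWithin_le_nhds, ?_⟩
    filter_upwards [hNW] with z hz
    exact Set.mem_image_of_mem F hz
  obtain ⟨t, ht, htℓ⟩ := hℓ
  obtain ⟨z, hzℓ, ⟨hzd, hzNW⟩, hzV⟩ := ((frequently_map_sub_ne_zero hN.1 hp ht
    (ℓ.restrictScalars ℝ) htℓ).and_eventually (((hcont.eventually hd).and hNW).and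
      (mem_nhdsWithin_of_mem_nhds hV))).exists
  have hinj : ∀ z ∈ N ∩ V, ∀ u ∈ tangentSpace N z, fderiv ℂ F z u = 0 → u = 0 := fun z hz =>
    himm z hz _ (by rw [hF, fderiv_foldMap, sub_self, norm_zero]; exact hc₀.le)
  have h1 := crDim_image_add_holRank hN hW hFd hM hzNW (hinj z ⟨hzNW.1, hzV⟩)
  have h2 := crDim_image_add_holRank hN hW hFd hM ⟨hp, hpW⟩ (hinj p ⟨hp, mem_of_mem_nhds hV⟩)
  have h3 : crDim (F '' (N ∩ W)) (F p) = d := (hcont.eventually hd).self_of_nhdsWithin hp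
  have h4 : holRank F z = n := (holRank_foldMap hl hAB z).2 hzℓ
  have h5 : holRank F p ≠ n := fun h => (holRank_foldMap hl hAB p).1 h (by simp)
  omega

end Robust

end CRImage
theorem proposition5p3 {n m k : ℕ} (N U : Set (CRImage.Cn n)) (F : CRImage.Cn n → CRImage.Cn m)
    (hN : CRImage.IsGenericSubmanifold k N) (hNconn : IsConnected N) (hk : 2 ≤ k)
    (hU : IsOpen U) (hNU : N ⊆ U) (hF : DifferentiableOn ℂ F U)
    (hFdiffeo : CRImage.IsDiffeoOntoImage F N) (hFrank : CRImage.GenericallyFullRank F U)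
    (hdim : 4 * (n : ℤ) - (k : ℤ) ≥ 2 * ((m : ℤ) + 1)) :
    ∀ p ∈ N, ∀ δ : ℝ, 0 < δ →
      ∃ (U' : Set (CRImage.Cn n)) (F' : CRImage.Cn n → CRImage.Cn m),
        IsOpen U' ∧ p ∈ U' ∧ U' ⊆ U ∧ DifferentiableOn ℂ F' U' ∧
        CRImage.supDist U' F F' < ENNReal.ofReal δ ∧
        CRImage.IsDiffeoOntoImage F' (N ∩ U') ∧
        CRImage.GenericallyFullRank F' U' ∧
        CRImage.IsCRSingularAt (F' '' (N ∩ U')) (F' p) ∧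
        ∀ W : Set (CRImage.Cn n), IsOpen W → p ∈ W → W ⊆ U' →
          ∃ ε : ℝ, 0 < ε ∧ ∀ G : CRImage.Cn n → CRImage.Cn m, DifferentiableOn ℂ G W →
            CRImage.supDist W F' G < ENNReal.ofReal ε →
              (∃ z ∈ N ∩ W, CRImage.holRank G z ≠ n) ∧
              ¬ CRImage.IsCRSubmanifold (G '' (N ∩ W)) := by

  intro p hp δ hδ
  have hnm : n ≤ m := hFrank.le ⟨p, hNU hp⟩
  obtain ⟨r, hr⟩ : ∃ r : ℕ, m + 1 = n + r := ⟨m + 1 - n, by omega⟩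
  have hdimT := hN.1.finrank_tangentSpace hp
  obtain ⟨v, hv, hvT⟩ := CRImage.exists_complex_line_disjoint (hN.2 p hp) hdimT hk
  obtain ⟨ℓ₀, hℓ₀⟩ := CRImage.exists_linearMap_surjOn r (CRImage.tangentSpace N p) (by omega)
  obtain ⟨l₀, hl₀⟩ := Module.Projective.exists_dual_eq_one ℂ hv
  obtain ⟨A, B, hAB, hAB'⟩ := CRImage.exists_splitting hr hv
  set ℓ : CRImage.Cn n →L[ℂ] (Fin r → ℂ) := LinearMap.toContinuousLinearMap ℓ₀ with hℓdef
  set l : CRImage.Cn n →L[ℂ] ℂ := LinearMap.toContinuousLinearMap l₀ with hldef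
  have hℓ : ∀ c, ∃ t ∈ CRImage.tangentSpace N p, ℓ t = c := hℓ₀
  have hl : l v = 1 := hl₀
  have hAT : ∀ u ∈ CRImage.tangentSpace N p, A u = 0 → u = 0 := by
    intro u hu hAu
    obtain ⟨⟨a, rfl⟩, -⟩ := (hAB u 0).1 (by rw [hAu, map_zero, add_zero])
    rw [hvT a hu, zero_smul]
  have hrpos : 0 < r := by omega
  obtain ⟨t, ht, htℓ⟩ : ∃ t ∈ CRImage.tangentSpace N p, ℓ t ≠ 0 := by
    obtain ⟨t, ht, htℓ⟩ := hℓ (fun _ => 1)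
    refine ⟨t, ht, fun h0 => ?_⟩
    have h1 := congrFun (htℓ.symm.trans h0) ⟨0, hrpos⟩
    simp at h1
  set F' := CRImage.foldMap A B ℓ l v p (F p) with hF'
  have hF'd : Differentiable ℂ F' := CRImage.differentiable_foldMap A B ℓ l v p (F p)
  have hF'p : F' p = F p := CRImage.foldMap_self A B ℓ l v p (F p)
  have hreal : fderiv ℝ F' p = A.restrictScalars ℝ := by
    have h := (CRImage.hasFDerivAt_foldMap A B ℓ l v p (F p) p).restrictScalars ℝ
    rw [CRImage.foldDeriv_self] at h
    exact h.fderiv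
  obtain ⟨O, hO, hpO, hdiffeo⟩ := CRImage.exists_isDiffeoOntoImage (f := F') hN.1 hp
    (CRImage.analyticAt_foldMap A B ℓ l v p (F p)) (fun u hu h0 => hAT u hu (by
      rw [hreal] at h0; exact h0))
  have hclose : ∀ᶠ z in 𝓝 p, ‖F z - F' z‖ < δ / 2 := by
    have : ContinuousAt (fun z => ‖F z - F' z‖) p :=
      ((hF.differentiableAt (hU.mem_nhds (hNU hp))).continuousAt.sub
        (hF'd p).continuousAt).norm
    refine this.eventually_lt_const ?_
    beta_reduce
    rw [hF'p, sub_self, norm_zero]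
    positivity
  obtain ⟨V, hV, hVo, hpV⟩ := mem_nhds_iff.1 hclose
  have hU'o : IsOpen (U ∩ (O ∩ V)) := hU.inter (hO.inter hVo)
  have hpU' : p ∈ U ∩ (O ∩ V) := ⟨hNU hp, hpO, hpV⟩
  have hdiff := hdiffeo _ hU'o (Set.inter_subset_right.trans Set.inter_subset_left)
  refine ⟨U ∩ (O ∩ V), F', hU'o, hpU', Set.inter_subset_left, hF'd.differentiableOn,
    CRImage.supDist_lt_of_bound hδ fun z hz => (hV hz.2.2).le, hdiff,
    CRImage.genericallyFullRank_foldMap hl hAB ⟨t, htℓ⟩ hU'o,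
    ⟨hdiff.1, Set.mem_image_of_mem _ ⟨hp, hpU'⟩, ?_⟩, fun W hW hpW _ => ?_⟩
  · obtain ⟨k', hk'⟩ := hdiff.1
    exact CRImage.not_isCRPoint_foldMap hN hp hAT hl hAB ⟨t, ht, htℓ⟩ hU'o hpU' hk'
  · obtain ⟨ε, hε, h⟩ := CRImage.exists_pos_forall_close_not_isCRSubmanifold (q := F p) hN hp hAT hl
      hAB hAB' hℓ hrpos hW hpW
    exact ⟨ε, hε, fun G hG hGε => h G hG (CRImage.norm_sub_le_of_supDist_lt hε hGε)⟩
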